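/- Conventions. All graphs are finite and without multiple edges; loops are allowed. For an undirected graph $\Gamma$, let $\overrightarrow{\Gamma}$ be the directed graph on the same vertices that has the edges $(v,w)$ and $(w,v)$ whenever $v$ and $w$ are adjacent in $\Gamma$; its vertex matrix is the symmetric $0/1$ matrix $D$ with $D_{vw}=1$ iff $(v,w)$ is an edge. For a finite directed graph $G$ with source and target maps $s,t$, the graph $C^*$-algebra $C^*(G)$ is the universal $C^*$-algebra generated by mutually orthogonal projections $p_v$ ($v$ a vertex) and partial isometries $S_e$ ($e$ an edge) with $S_e^*S_e=p_{t(e)}$ for every edge $e$ and $\sum_{s(e)=v}S_eS_e^*=p_v$ for every vertex $v$ that emits an edge; it is unital with unit $\sum_v p_v$. Its dynamics $\sigma$ is given by $\sigma_t(p_v)=p_v$ and $\sigma_t(S_e)=e^{it}S_e$ for $t\in\mathbb{R}$. An element $a$ is analytic if $t\mapsto\sigma_t(a)$ extends to an entire function $z\mapsto\sigma_z(a)$, and a KMS state at inverse temperature $\beta\in\mathbb{R}$ is a state $\tau$ with $\tau(ab)=\tau(b\,\sigma_{i\beta}(a))$ for all analytic $a,b$. An automorphism $g$ of $G$ acts on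 $C^*(G)$ by $p_v\mapsto p_{g(v)}$, $S_e\mapsto S_{g(e)}$. Proposition. Let $\Gamma_1$ and $\Gamma_2$ be non-isomorphic connected (in particular non-empty) undirected graphs such that the vertex matrices of $\overrightarrow{\Gamma_1}$ and $\overrightarrow{\Gamma_2}$ have the same spectral radius $\lambda$, and let $\Gamma=\Gamma_1\cup\Gamma_2$ be their disjoint union. Then: 1. the vertex matrix of $\overrightarrow{\Gamma}$ has spectral radius $\lambda$, so that $\ln\lambda$ is the critical inverse temperature of $\overrightarrow{\Gamma}$; 2. $C^*(\overrightarrow{\Gamma})$ has infinitely many KMS states at inverse temperature $\ln\lambda$; 3. every KMS state of $C^*(\overrightarrow{\Gamma})$ at inverse temperature $\ln\lambda$ is invariant under the action of $\mathrm{Aut}(\overrightarrow{\Gamma})$; 4. the map $\mathrm{Aut}(\overrightarrow{\Gamma_1})\times\mathrm{Aut}(\overrightarrow{\Gamma_2})\to\mathrm{Aut}(\overrightarrow{\Gamma})$ which sends $(g_1,g_2)$ to the automorphism acting as $g_i$ on the vertices of $\Gamma_i$ is a group isomorphism. -/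

import Mathlib

open scoped ComplexOrder NNReal ENNReal

universe u v

noncomputable section

/-! ### Graphs -/

/-- An undirected graph without multiple edges on the vertex set `V`; loops are allowed. -/
structure UndirectedGraph (V : Type u) where
  /-- Adjacency. -/
  Adj : V → V → Prop
  symm : ∀ v w, Adj v w → Adj w v

namespace UndirectedGraph

/-- The directed version: every edge between `v` and `w` becomes the two directed edges
`(v, w)` and `(w, v)` (a loop becomes one directed loop). -/
def directed {V : Type u} (Γ : UndirectedGraph V) : Digraph V where
  Adj := Γ.Adj

/-- There is at least one vertex, and any two vertices are joined by a path. -/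
def Connected {V : Type u} (Γ : UndirectedGraph V) : Prop :=
  Nonempty V ∧ ∀ v w, Relation.ReflTransGen Γ.Adj v w

/-- Isomorphisms of undirected graphs. -/
abbrev Iso {V : Type u} {W : Type v} (Γ : UndirectedGraph V) (Λ : UndirectedGraph W) :=
  Γ.Adj ≃r Λ.Adj

/-- Disjoint union. -/
def disjUnion {V : Type u} {W : Type v} (Γ : UndirectedGraph V) (Λ : UndirectedGraph W) :
    UndirectedGraph (V ⊕ W) where
  Adj := Sum.LiftRel Γ.Adj Λ.Adj
  symm := by
    rintro _ _ (⟨h⟩ | ⟨h⟩)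
    · exact .inl (Γ.symm _ _ h)
    · exact .inr (Λ.symm _ _ h)

end UndirectedGraph

namespace Digraph

/-- The automorphism group of a directed graph without multiple edges. -/
abbrev Aut {V : Type u} (G : Digraph V) := G.Adj ≃r G.Adj

/-- The vertex matrix. -/
def vertexMatrix {V : Type u} (G : Digraph V) : Matrix V V ℂ :=
  open scoped Classical in Matrix.of fun v w => if G.Adj v w then 1 else 0

/-- Directed edges. -/
structure Edge {V : Type u} (G : Digraph V) where
  /-- source -/
  src : V
  /-- target -/
  tgt : V
  adj : G.Adj src tgt

theorem Edge.eq_of {V : Type u} {G : Digraph V} {e f : G.Edge} (h₁ : e.src = f.src)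
    (h₂ : e.tgt = f.tgt) : e = f := by
  cases e; cases f; cases h₁; cases h₂; rfl

instance {V : Type u} [Fintype V] (G : Digraph V) : Fintype G.Edge :=
  open scoped Classical in
  Fintype.ofInjective (fun e : G.Edge => (e.src, e.tgt)) fun _ _ h =>
    Edge.eq_of (Prod.ext_iff.1 h).1 (Prod.ext_iff.1 h).2

/-- The action of an automorphism on edges. -/
def Aut.edge {V : Type u} {G : Digraph V} (g : G.Aut) (e : G.Edge) : G.Edge :=
  ⟨g e.src, g e.tgt, g.map_rel_iff.2 e.adj⟩

end Digraph

/-! ### Cuntz–Krieger families -/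

/-- A Cuntz–Krieger family of a finite directed graph in a unital C⋆-algebra `A`: mutually
orthogonal projections `p v` and elements `S e` with `S e⋆ S e = p (t e)` (so that `S e` is a
partial isometry) and `∑_{s e = v} S e S e⋆ = p v` at every vertex `v` which is not a sink.
As there are finitely many vertices, `∑ p v` is a unit of the C⋆-algebra generated by the family;
it is required to be the unit of `A`. -/
structure CKFamily {V : Type u} [Fintype V] (G : Digraph V) (A : Type v) [CStarAlgebra A] where
  /-- vertex projections -/
  p : V → A
  /-- edge partial isometries -/
  S : G.Edge → A
  p_proj : ∀ v, IsStarProjection (p v)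
  p_orth : ∀ v w, v ≠ w → p v * p w = 0
  star_mul_self : ∀ e, star (S e) * S e = p e.tgt
  sum_edges : open scoped Classical in ∀ v, (∃ e : G.Edge, e.src = v) →
    ∑ e : G.Edge with e.src = v, S e * star (S e) = p v
  sum_one : ∑ v, p v = 1

/-! ### The free unital ⋆-algebra -/

/-- The free unital complex ⋆-algebra on `X`: the algebra of noncommutative polynomials in letters
`x = (x, false)` and `x⋆ = (x, true)`. -/
def FreeStarAlg (X : Type u) : Type u := MonoidAlgebra ℂ (FreeMonoid (X × Bool))

namespace FreeStarAlg

variable {X : Type u}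

instance : Ring (FreeStarAlg X) := inferInstanceAs (Ring (MonoidAlgebra ℂ _))

instance : Algebra ℂ (FreeStarAlg X) := inferInstanceAs (Algebra ℂ (MonoidAlgebra ℂ _))

/-- The scalar multiple `c w` of a word `w`. -/
def mono (w : FreeMonoid (X × Bool)) (c : ℂ) : FreeStarAlg X := MonoidAlgebra.single w c

theorem ind {P : FreeStarAlg X → Prop} (zero : P 0)
    (add : ∀ a b, P a → P b → P (a + b)) (mono : ∀ w c, P (mono w c)) (a : FreeStarAlg X) : P a :=
  MonoidAlgebra.induction_linear a zero add mono

theorem mono_mul (w w' : FreeMonoid (X × Bool)) (c c' : ℂ) :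
    mono w c * mono w' c' = mono (w * w') (c * c') :=
  MonoidAlgebra.single_mul_single w w' c c'

theorem smul_mono (w : FreeMonoid (X × Bool)) (c d : ℂ) :
    d • mono w c = mono w (d * c) := MonoidAlgebra.smul_single d w c

/-- Adjoint of a word: reverse it and exchange `x` with `x⋆`. -/
def wordStar (w : FreeMonoid (X × Bool)) : FreeMonoid (X × Bool) :=
  FreeMonoid.reverse (FreeMonoid.map (fun x => (x.1, !x.2)) w)

theorem wordStar_mul (w w' : FreeMonoid (X × Bool)) :
    wordStar (w * w') = wordStar w' * wordStar w := by
  simp [wordStar, FreeMonoid.reverse_mul]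

theorem wordStar_wordStar (w : FreeMonoid (X × Bool)) : wordStar (wordStar w) = w := by
  induction w using FreeMonoid.inductionOn' with
  | one => rfl
  | of_mul x w ih =>
    rw [wordStar_mul, wordStar_mul, ih]
    simp [wordStar]

/-- The involution as an additive map; it takes `c w` to `conj c w⋆`. -/
def starHom : FreeStarAlg X →+ FreeStarAlg X :=
  MonoidAlgebra.liftNC
    ((MonoidAlgebra.singleAddHom (1 : FreeMonoid (X × Bool))).comp
      (starRingEnd ℂ).toAddMonoidHom : ℂ →+ FreeStarAlg X)
    (fun w => mono (wordStar w) 1)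

theorem starHom_mono (w : FreeMonoid (X × Bool)) (c : ℂ) :
    starHom (mono w c) = mono (wordStar w) (starRingEnd ℂ c) := by
  refine (MonoidAlgebra.liftNC_single _ _ _ _).trans ?_
  refine (mono_mul 1 (wordStar w) (starRingEnd ℂ c) 1).trans ?_
  rw [one_mul, mul_one]

instance : StarRing (FreeStarAlg X) where
  star := starHom
  star_involutive a := by
    induction a using ind with
    | zero => rw [map_zero, map_zero]
    | add a b ha hb => rw [map_add, map_add, ha, hb]
    | mono w c => rw [starHom_mono, starHom_mono, wordStar_wordStar, Complex.conj_conj]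
  star_mul a b := by
    change starHom (a * b) = starHom b * starHom a
    induction a using ind with
    | zero => rw [zero_mul, map_zero, mul_zero]
    | add a a' ha ha' => rw [add_mul, map_add, map_add, mul_add, ha, ha']
    | mono w c =>
      induction b using ind with
      | zero => rw [mul_zero, map_zero, zero_mul]
      | add b b' hb hb' => rw [mul_add, map_add, map_add, add_mul, hb, hb']
      | mono w' c' =>
        rw [mono_mul, starHom_mono, starHom_mono, starHom_mono, mono_mul, wordStar_mul, map_mul,
          mul_comm]
  star_add a b := map_add starHom a b

theorem star_mono (w : FreeMonoid (X × Bool)) (c : ℂ) :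
    star (mono w c) = mono (wordStar w) (starRingEnd ℂ c) := starHom_mono w c

instance : StarModule ℂ (FreeStarAlg X) where
  star_smul c a := by
    induction a using ind with
    | zero => rw [smul_zero, star_zero, smul_zero]
    | add a b ha hb => rw [smul_add, star_add, star_add, smul_add, ha, hb]
    | mono w d =>
      rw [smul_mono, star_mono, star_mono, smul_mono, map_mul]
      rfl

/-- The generator attached to `x`. -/
def gen (x : X) : FreeStarAlg X := mono (FreeMonoid.of (x, false)) 1

theorem star_gen (x : X) : star (gen x) = mono (FreeMonoid.of (x, true)) 1 := by
  rw [gen, star_mono, map_one]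
  rfl

variable {A : Type v} [Ring A] [StarRing A]

/-- Evaluation of a word. -/
def evalWord (f : X → A) : FreeMonoid (X × Bool) →* A :=
  FreeMonoid.lift fun x => if x.2 then star (f x.1) else f x.1

theorem evalWord_wordStar (f : X → A) (w : FreeMonoid (X × Bool)) :
    evalWord f (wordStar w) = star (evalWord f w) := by
  induction w using FreeMonoid.inductionOn' with
  | one => exact (map_one (evalWord f)).trans (by rw [map_one, star_one])
  | of_mul x w ih =>
    rw [wordStar_mul, map_mul, map_mul, star_mul, ih]
    congr 1
    obtain ⟨x, _ | _⟩ := x <;> simp [wordStar, evalWord]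

variable [Algebra ℂ A]

/-- Evaluation of noncommutative ⋆-polynomials, as an algebra homomorphism. -/
def evalAlg (f : X → A) : FreeStarAlg X →ₐ[ℂ] A :=
  MonoidAlgebra.lift ℂ A (FreeMonoid (X × Bool)) (evalWord f)

theorem evalAlg_mono (f : X → A) (w : FreeMonoid (X × Bool)) (c : ℂ) :
    evalAlg f (mono w c) = c • evalWord f w := MonoidAlgebra.lift_single _ _ _

/-- Evaluation of noncommutative ⋆-polynomials. -/
def eval [StarModule ℂ A] (f : X → A) : FreeStarAlg X →⋆ₐ[ℂ] A where
  __ := evalAlg f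
  map_star' a := by
    change evalAlg f (star a) = star (evalAlg f a)
    induction a using ind with
    | zero => rw [star_zero, map_zero, star_zero]
    | add a b ha hb => rw [star_add, map_add, map_add, star_add, ha, hb]
    | mono w c =>
      rw [star_mono, evalAlg_mono, evalAlg_mono, evalWord_wordStar, star_smul]
      rfl

theorem eval_mono [StarModule ℂ A] (f : X → A) (w : FreeMonoid (X × Bool)) (c : ℂ) :
    eval f (mono w c) = c • evalWord f w := evalAlg_mono f w c

theorem eval_gen [StarModule ℂ A] (f : X → A) (x : X) : eval f (gen x) = f x := by
  rw [gen, eval_mono, one_smul]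
  simp [evalWord]

end FreeStarAlg

/-! ### The graph C⋆-algebra -/

namespace CKFamily

variable {V : Type u} [Fintype V] {G : Digraph V} {A : Type v} [CStarAlgebra A]

/-- The values of the generators. -/
def val (f : CKFamily G A) : V ⊕ G.Edge → A := Sum.elim f.p f.S

/-- Evaluation of ⋆-polynomials at a Cuntz–Krieger family. -/
def eval (f : CKFamily G A) : FreeStarAlg (V ⊕ G.Edge) →⋆ₐ[ℂ] A := FreeStarAlg.eval f.val

theorem norm_val_le (f : CKFamily G A) (x : V ⊕ G.Edge) : ‖f.val x‖ ≤ 1 := by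
  rcases x with v | e
  · exact (f.p_proj v).norm_le
  · have h : ‖f.S e‖ * ‖f.S e‖ ≤ 1 := by
      rw [← CStarRing.norm_star_mul_self, f.star_mul_self]
      exact (f.p_proj _).norm_le
    change ‖f.S e‖ ≤ 1
    nlinarith [norm_nonneg (f.S e)]

theorem norm_one_le : ‖(1 : A)‖ ≤ 1 :=
  IsStarProjection.norm_le 1 ⟨one_mul 1, star_one A⟩

theorem norm_evalWord_le (f : CKFamily G A) (w : FreeMonoid ((V ⊕ G.Edge) × Bool)) :
    ‖FreeStarAlg.evalWord f.val w‖ ≤ 1 := by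
  induction w using FreeMonoid.inductionOn' with
  | one => simpa using norm_one_le
  | of_mul x w ih =>
    rw [map_mul]
    refine (norm_mul_le _ _).trans (mul_le_one₀ ?_ (norm_nonneg _) ih)
    obtain ⟨x, _ | _⟩ := x
    · simpa [FreeStarAlg.evalWord] using f.norm_val_le x
    · simpa [FreeStarAlg.evalWord] using f.norm_val_le x

end CKFamily

/-- The free ⋆-algebra on the vertices and edges, to be normed by the universal seminorm. -/
def PreGraphAlgebra {V : Type u} (G : Digraph V) : Type u := FreeStarAlg (V ⊕ G.Edge)

namespace PreGraphAlgebra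

variable {V : Type u} [Fintype V] {G : Digraph V}

instance : Ring (PreGraphAlgebra G) := inferInstanceAs (Ring (FreeStarAlg _))

instance : Algebra ℂ (PreGraphAlgebra G) := inferInstanceAs (Algebra ℂ (FreeStarAlg _))

instance : StarRing (PreGraphAlgebra G) := inferInstanceAs (StarRing (FreeStarAlg _))

instance : StarModule ℂ (PreGraphAlgebra G) := inferInstanceAs (StarModule ℂ (FreeStarAlg _))

/-- Evaluation at a Cuntz–Krieger family. -/
def ev {A : Type v} [CStarAlgebra A] (f : CKFamily G A) : PreGraphAlgebra G →⋆ₐ[ℂ] A := f.eval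

/-- The values at `a` of the seminorms given by all Cuntz–Krieger families. -/
def normSet (a : PreGraphAlgebra G) : Set ℝ :=
  {r | ∃ (A : Type u) (_ : CStarAlgebra A) (f : CKFamily G A), r = ‖ev f a‖}

theorem exists_bound (a : PreGraphAlgebra G) :
    ∃ C, ∀ (A : Type u) (_ : CStarAlgebra A) (f : CKFamily G A), ‖ev f a‖ ≤ C := by
  induction a using FreeStarAlg.ind with
  | zero => exact ⟨0, fun A _ f => (congrArg norm (map_zero (ev f))).le.trans norm_zero.le⟩
  | add a b ha hb =>
    obtain ⟨C, hC⟩ := ha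
    obtain ⟨D, hD⟩ := hb
    exact ⟨C + D, fun A _ f => (congrArg norm (map_add (ev f) a b)).le.trans
      ((norm_add_le _ _).trans (add_le_add (hC A _ f) (hD A _ f)))⟩
  | mono w c =>
    refine ⟨‖c‖, fun A _ f => (congrArg norm (FreeStarAlg.eval_mono f.val w c)).le.trans ?_⟩
    rw [norm_smul]
    exact mul_le_of_le_one_right (norm_nonneg _) (f.norm_evalWord_le w)

theorem bddAbove_normSet (a : PreGraphAlgebra G) : BddAbove (normSet a) := by
  obtain ⟨C, hC⟩ := exists_bound a
  refine ⟨C, ?_⟩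
  rintro _ ⟨A, i, f, rfl⟩
  exact hC A i f

/-- The universal seminorm: the supremum over all Cuntz–Krieger families. -/
instance : Norm (PreGraphAlgebra G) := ⟨fun a => sSup (normSet a)⟩

theorem norm_def (a : PreGraphAlgebra G) : ‖a‖ = sSup (normSet a) := rfl

theorem norm_ev_le {A : Type u} [CStarAlgebra A] (f : CKFamily G A) (a : PreGraphAlgebra G) :
    ‖ev f a‖ ≤ ‖a‖ := le_csSup (bddAbove_normSet a) ⟨A, _, f, rfl⟩

theorem nonneg (a : PreGraphAlgebra G) : 0 ≤ ‖a‖ := by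
  refine Real.sSup_nonneg ?_
  rintro _ ⟨A, i, f, rfl⟩
  exact norm_nonneg _

theorem norm_le {a : PreGraphAlgebra G} {C : ℝ} (hC : 0 ≤ C)
    (h : ∀ (A : Type u) [CStarAlgebra A] (f : CKFamily G A), ‖ev f a‖ ≤ C) : ‖a‖ ≤ C := by
  refine Real.sSup_le ?_ hC
  rintro _ ⟨A, i, f, rfl⟩
  exact h A f

instance : SeminormedRing (PreGraphAlgebra G) where
  __ := (AddGroupSeminorm.mk (fun a : PreGraphAlgebra G => ‖a‖)
    (le_antisymm (norm_le le_rfl fun A _ f => by simp) (nonneg _))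
    (fun a b => norm_le (add_nonneg (nonneg a) (nonneg b)) fun A _ f => by
      rw [map_add]
      exact (norm_add_le _ _).trans (add_le_add (norm_ev_le f a) (norm_ev_le f b)))
    (fun a => by simp [norm_def, normSet])).toSeminormedAddCommGroup
  __ := (inferInstance : Ring (PreGraphAlgebra G))
  norm_mul_le a b := norm_le (mul_nonneg (nonneg a) (nonneg b)) fun A _ f => by
    rw [map_mul]
    exact (norm_mul_le _ _).trans
      (mul_le_mul (norm_ev_le f a) (norm_ev_le f b) (norm_nonneg _) (nonneg a))

instance : NormedAlgebra ℂ (PreGraphAlgebra G) where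
  norm_smul_le c a := norm_le (mul_nonneg (norm_nonneg c) (nonneg a)) fun A _ f => by
    rw [map_smul, norm_smul]
    exact mul_le_mul_of_nonneg_left (norm_ev_le f a) (norm_nonneg c)

theorem norm_star_le (a : PreGraphAlgebra G) : ‖star a‖ ≤ ‖a‖ :=
  norm_le (nonneg a) fun A _ f => by
    rw [map_star, norm_star]
    exact norm_ev_le f a

theorem norm_mul_self_le (a : PreGraphAlgebra G) : ‖a‖ * ‖a‖ ≤ ‖star a * a‖ := by
  have h : ‖a‖ ≤ √‖star a * a‖ := norm_le (Real.sqrt_nonneg _) fun A _ f => by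
    refine Real.le_sqrt_of_sq_le ?_
    rw [sq, ← CStarRing.norm_star_mul_self, ← map_star, ← map_mul]
    exact norm_ev_le f _
  calc ‖a‖ * ‖a‖ ≤ √‖star a * a‖ * √‖star a * a‖ := mul_self_le_mul_self (nonneg a) h
    _ = ‖star a * a‖ := Real.mul_self_sqrt (nonneg _)

theorem lipschitz_star : LipschitzWith 1 (star : PreGraphAlgebra G → PreGraphAlgebra G) :=
  LipschitzWith.of_dist_le_mul fun a b => by
    rw [dist_eq_norm, dist_eq_norm, ← star_sub, NNReal.coe_one, one_mul]
    exact norm_star_le _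

theorem lipschitz_ev {A : Type u} [CStarAlgebra A] (f : CKFamily G A) :
    LipschitzWith 1 (ev f) :=
  LipschitzWith.of_dist_le_mul fun a b => by
    rw [dist_eq_norm, dist_eq_norm, ← map_sub, NNReal.coe_one, one_mul]
    exact norm_ev_le f _

end PreGraphAlgebra

/-- The graph C⋆-algebra `C⋆(G)` of a finite directed graph: the universal C⋆-algebra generated by a
Cuntz–Krieger family, that is, the (separated) completion of the free ⋆-algebra on the vertices and
edges in the universal seminorm. -/
def GraphCStar {V : Type u} [Fintype V] (G : Digraph V) : Type u :=
  UniformSpace.Completion (PreGraphAlgebra G)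

namespace GraphCStar

open UniformSpace

variable {V : Type u} [Fintype V] {G : Digraph V}

instance : NormedRing (GraphCStar G) :=
  inferInstanceAs (NormedRing (Completion (PreGraphAlgebra G)))

instance : CompleteSpace (GraphCStar G) :=
  inferInstanceAs (CompleteSpace (Completion (PreGraphAlgebra G)))

instance : Algebra ℂ (GraphCStar G) :=
  inferInstanceAs (Algebra ℂ (Completion (PreGraphAlgebra G)))

instance : NormedAlgebra ℂ (GraphCStar G) where
  norm_smul_le c a := norm_smul_le (β := Completion (PreGraphAlgebra G)) c a

/-- The canonical map of the free ⋆-algebra into the graph algebra. -/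
def of (a : PreGraphAlgebra G) : GraphCStar G := (a : Completion (PreGraphAlgebra G))

theorem of_add (a b : PreGraphAlgebra G) : of (a + b) = of a + of b := Completion.coe_add a b

theorem of_mul (a b : PreGraphAlgebra G) : of (a * b) = of a * of b := Completion.coe_mul a b

theorem of_one : of (1 : PreGraphAlgebra G) = 1 := rfl

theorem of_smul (c : ℂ) (a : PreGraphAlgebra G) : of (c • a) = c • of a := Completion.coe_smul c a

theorem norm_of (a : PreGraphAlgebra G) : ‖of a‖ = ‖a‖ := Completion.norm_coe a

theorem continuous_of : Continuous (of : PreGraphAlgebra G → GraphCStar G) :=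
  Completion.continuous_coe _

theorem dense_of : DenseRange (of : PreGraphAlgebra G → GraphCStar G) :=
  Completion.denseRange_coe

instance : Star (GraphCStar G) :=
  ⟨Completion.map (star : PreGraphAlgebra G → PreGraphAlgebra G)⟩

theorem continuous_star' : Continuous (star : GraphCStar G → GraphCStar G) :=
  Completion.continuous_map

theorem star_of (a : PreGraphAlgebra G) : star (of a) = of (star a) :=
  Completion.map_coe PreGraphAlgebra.lipschitz_star.uniformContinuous a

instance : StarRing (GraphCStar G) where
  star_involutive a := by
    refine dense_of.induction_on a
      (isClosed_eq (continuous_star'.comp continuous_star') continuous_id) fun a => ?_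
    rw [star_of, star_of, star_star]
  star_mul a b := by
    refine dense_of.induction_on₂ (p := fun a b : GraphCStar G => star (a * b) = star b * star a)
      (isClosed_eq (continuous_star'.comp continuous_mul)
        ((continuous_star'.comp continuous_snd).mul (continuous_star'.comp continuous_fst)))
      (fun a b => ?_) a b
    rw [← of_mul, star_of, star_of, star_of, star_mul, of_mul]
  star_add a b := by
    refine dense_of.induction_on₂ (p := fun a b : GraphCStar G => star (a + b) = star a + star b)
      (isClosed_eq (continuous_star'.comp continuous_add)
        ((continuous_star'.comp continuous_fst).add (continuous_star'.comp continuous_snd)))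
      (fun a b => ?_) a b
    rw [← of_add, star_of, star_of, star_of, star_add, of_add]

instance : CStarAlgebra (GraphCStar G) where
  norm_mul_self_le a := by
    refine dense_of.induction_on a (isClosed_le (continuous_norm.mul continuous_norm)
      (continuous_norm.comp (continuous_star'.mul continuous_id))) fun a => ?_
    rw [star_of, ← of_mul, norm_of, norm_of]
    exact PreGraphAlgebra.norm_mul_self_le a
  star_smul c a := by
    refine dense_of.induction_on a (isClosed_eq
      (continuous_star'.comp (continuous_const_smul c))
      (continuous_star'.const_smul (star c))) fun a => ?_
    rw [← of_smul, star_of, star_of, star_smul, of_smul]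

/-- `of` as a homomorphism of ⋆-algebras. -/
def ofHom : PreGraphAlgebra G →⋆ₐ[ℂ] GraphCStar G where
  toFun := of
  map_one' := of_one
  map_zero' := Completion.coe_zero
  map_mul' := of_mul
  map_add' := of_add
  commutes' _ := rfl
  map_star' a := (star_of a).symm

theorem ofHom_eq_of {a b : PreGraphAlgebra G} (h : ∀ (A : Type u) [CStarAlgebra A]
    (f : CKFamily G A), PreGraphAlgebra.ev f a = PreGraphAlgebra.ev f b) : ofHom a = ofHom b := by
  rw [← sub_eq_zero, ← map_sub, ← norm_eq_zero]
  refine (norm_of (a - b)).trans (le_antisymm ?_ (norm_nonneg _))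
  refine PreGraphAlgebra.norm_le le_rfl fun A _ f => ?_
  rw [map_sub, h A f, sub_self, norm_zero]

/-- The generator of the free ⋆-algebra attached to a vertex. -/
def pGen (v : V) : PreGraphAlgebra G := FreeStarAlg.gen (Sum.inl v)

/-- The generator of the free ⋆-algebra attached to an edge. -/
def SGen (e : G.Edge) : PreGraphAlgebra G := FreeStarAlg.gen (Sum.inr e)

theorem ev_pGen {A : Type v} [CStarAlgebra A] (f : CKFamily G A) (v : V) :
    PreGraphAlgebra.ev f (pGen v) = f.p v := FreeStarAlg.eval_gen _ _

theorem ev_SGen {A : Type v} [CStarAlgebra A] (f : CKFamily G A) (e : G.Edge) :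
    PreGraphAlgebra.ev f (SGen e) = f.S e := FreeStarAlg.eval_gen _ _

variable (G) in
/-- The canonical Cuntz–Krieger family generating `C⋆(G)`. -/
def family : CKFamily G (GraphCStar G) where
  p v := ofHom (pGen v)
  S e := ofHom (SGen e)
  p_proj v := by
    constructor
    · rw [IsIdempotentElem, ← map_mul]
      refine ofHom_eq_of fun A _ f => ?_
      rw [map_mul, ev_pGen, (f.p_proj v).isIdempotentElem.eq]
    · rw [isSelfAdjoint_iff, ← map_star]
      refine ofHom_eq_of fun A _ f => ?_
      rw [map_star, ev_pGen, (f.p_proj v).isSelfAdjoint.star_eq]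
  p_orth v w h := by
    rw [← map_mul, ← map_zero ofHom]
    refine ofHom_eq_of fun A _ f => ?_
    rw [map_mul, ev_pGen, ev_pGen, map_zero, f.p_orth v w h]
  star_mul_self e := by
    rw [← map_star, ← map_mul]
    refine ofHom_eq_of fun A _ f => ?_
    rw [map_mul, map_star, ev_SGen, ev_pGen, f.star_mul_self]
  sum_edges v hv := by
    simp_rw [← map_star, ← map_mul, ← map_sum]
    refine ofHom_eq_of fun A _ f => ?_
    simp_rw [map_sum, map_mul, map_star, ev_SGen, ev_pGen]
    exact f.sum_edges v hv
  sum_one := by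
    rw [← map_sum, ← map_one ofHom]
    refine ofHom_eq_of fun A _ f => ?_
    simp_rw [map_sum, ev_pGen, map_one]
    exact f.sum_one

/-- The function underlying `lift`. -/
def liftFun {A : Type u} [CStarAlgebra A] (f : CKFamily G A) : GraphCStar G → A :=
  Completion.extension (PreGraphAlgebra.ev f)

theorem liftFun_of {A : Type u} [CStarAlgebra A] (f : CKFamily G A) (a : PreGraphAlgebra G) :
    liftFun f (of a) = PreGraphAlgebra.ev f a :=
  Completion.extension_coe (PreGraphAlgebra.lipschitz_ev f).uniformContinuous a

theorem continuous_liftFun {A : Type u} [CStarAlgebra A] (f : CKFamily G A) :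
    Continuous (liftFun f) := Completion.continuous_extension

/-- The ⋆-homomorphism of `C⋆(G)` given by a Cuntz–Krieger family. -/
def lift {A : Type u} [CStarAlgebra A] (f : CKFamily G A) : GraphCStar G →⋆ₐ[ℂ] A where
  toFun := liftFun f
  map_one' := (liftFun_of f 1).trans (map_one _)
  map_zero' := (liftFun_of f 0).trans (map_zero _)
  map_mul' a b := by
    refine dense_of.induction_on₂
      (p := fun a b : GraphCStar G => liftFun f (a * b) = liftFun f a * liftFun f b)
      (isClosed_eq ((continuous_liftFun f).comp continuous_mul)
        (((continuous_liftFun f).comp continuous_fst).mul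
          ((continuous_liftFun f).comp continuous_snd))) (fun a b => ?_) a b
    rw [← of_mul, liftFun_of, liftFun_of, liftFun_of, map_mul]
  map_add' a b := by
    refine dense_of.induction_on₂
      (p := fun a b : GraphCStar G => liftFun f (a + b) = liftFun f a + liftFun f b)
      (isClosed_eq ((continuous_liftFun f).comp continuous_add)
        (((continuous_liftFun f).comp continuous_fst).add
          ((continuous_liftFun f).comp continuous_snd))) (fun a b => ?_) a b
    rw [← of_add, liftFun_of, liftFun_of, liftFun_of, map_add]
  commutes' c := (liftFun_of f (algebraMap ℂ _ c)).trans
    (AlgHomClass.commutes (PreGraphAlgebra.ev f) c)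
  map_star' a := by
    refine dense_of.induction_on a (isClosed_eq ((continuous_liftFun f).comp continuous_star')
      (continuous_star.comp (continuous_liftFun f))) fun a => ?_
    rw [star_of, liftFun_of, liftFun_of, map_star]

theorem lift_p {A : Type u} [CStarAlgebra A] (f : CKFamily G A) (v : V) :
    lift f ((family G).p v) = f.p v := (liftFun_of f (pGen v)).trans (ev_pGen f v)

theorem lift_S {A : Type u} [CStarAlgebra A] (f : CKFamily G A) (e : G.Edge) :
    lift f ((family G).S e) = f.S e := (liftFun_of f (SGen e)).trans (ev_SGen f e)

/-- ⋆-homomorphisms of `C⋆(G)` are determined by their values on the canonical family; with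
`lift`, `lift_p` and `lift_S` this is the universal property. -/
theorem hom_ext {A : Type v} [CStarAlgebra A] {φ ψ : GraphCStar G →⋆ₐ[ℂ] A}
    (hp : ∀ v, φ ((family G).p v) = ψ ((family G).p v))
    (hS : ∀ e, φ ((family G).S e) = ψ ((family G).S e)) : φ = ψ := by
  have hφ : Continuous φ :=
    AddMonoidHomClass.continuous_of_bound φ 1 fun a => by
      simpa using NonUnitalStarAlgHom.norm_apply_le φ a
  have hψ : Continuous ψ :=
    AddMonoidHomClass.continuous_of_bound ψ 1 fun a => by
      simpa using NonUnitalStarAlgHom.norm_apply_le ψ a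
  have key : ∀ x, φ (ofHom (FreeStarAlg.gen x)) = ψ (ofHom (FreeStarAlg.gen x)) := by
    rintro (v | e)
    · exact hp v
    · exact hS e
  have key2 : ∀ w : FreeMonoid ((V ⊕ G.Edge) × Bool),
      φ (ofHom (FreeStarAlg.mono w 1)) = ψ (ofHom (FreeStarAlg.mono w 1)) := by
    intro w
    induction w using FreeMonoid.inductionOn' with
    | one => exact (map_one (φ.comp ofHom)).trans (map_one (ψ.comp ofHom)).symm
    | of_mul x w ih =>
      have h1 : (FreeStarAlg.mono (FreeMonoid.of x * w) 1 : FreeStarAlg (V ⊕ G.Edge)) =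
          FreeStarAlg.mono (FreeMonoid.of x) 1 * FreeStarAlg.mono w 1 := by
        rw [FreeStarAlg.mono_mul, mul_one]
      have h2 : φ (ofHom (FreeStarAlg.mono (FreeMonoid.of x) 1)) =
          ψ (ofHom (FreeStarAlg.mono (FreeMonoid.of x) 1)) := by
        obtain ⟨x, _ | _⟩ := x
        · exact key x
        · rw [← FreeStarAlg.star_gen]
          exact (map_star (φ.comp ofHom) _).trans
            ((congrArg star (key x)).trans (map_star (ψ.comp ofHom) _).symm)
      rw [h1]
      exact (map_mul (φ.comp ofHom) _ _).trans
        ((congrArg₂ (· * ·) h2 ih).trans (map_mul (ψ.comp ofHom) _ _).symm)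
  ext a
  refine dense_of.induction_on a (isClosed_eq hφ hψ) fun a => ?_
  change φ.comp ofHom a = ψ.comp ofHom a
  induction a using FreeStarAlg.ind with
  | zero => exact (map_zero (φ.comp ofHom)).trans (map_zero (ψ.comp ofHom)).symm
  | add a b ha hb =>
    exact (map_add (φ.comp ofHom) a b).trans
      ((congrArg₂ (· + ·) ha hb).trans (map_add (ψ.comp ofHom) a b).symm)
  | mono w c =>
    have h1 : (FreeStarAlg.mono w c : FreeStarAlg (V ⊕ G.Edge)) = c • FreeStarAlg.mono w 1 := by
      rw [FreeStarAlg.smul_mono, mul_one]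
    rw [h1]
    exact (map_smul (φ.comp ofHom) c _).trans
      ((congrArg (c • ·) (key2 w)).trans (map_smul (ψ.comp ofHom) c _).symm)

end GraphCStar

/-! ### Gauge action, dynamics, and the action of the automorphism group -/

namespace CKFamily

variable {V : Type u} [Fintype V] {G : Digraph V} {A : Type v} [CStarAlgebra A]

/-- The family `(p v, z S e)` for a complex number `z` of modulus one. -/
def rotate (f : CKFamily G A) (z : Circle) : CKFamily G A where
  p := f.p
  S e := (z : ℂ) • f.S e
  p_proj := f.p_proj
  p_orth := f.p_orth
  star_mul_self e := by
    rw [star_smul, smul_mul_smul_comm, f.star_mul_self]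
    simp [Complex.conj_mul', Circle.norm_coe]
  sum_edges v hv := by
    rw [← f.sum_edges v hv]
    refine Finset.sum_congr rfl fun e _ => ?_
    rw [star_smul, smul_mul_smul_comm]
    simp [Complex.mul_conj', Circle.norm_coe]
  sum_one := f.sum_one

/-- The family `(p (g v), S (g e))` for an automorphism `g` of the graph. -/
def permute (f : CKFamily G A) (g : G.Aut) : CKFamily G A where
  p v := f.p (g v)
  S e := f.S (g.edge e)
  p_proj v := f.p_proj (g v)
  p_orth v w h := f.p_orth _ _ fun h' => h (g.injective h')
  star_mul_self e := f.star_mul_self (g.edge e)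
  sum_edges v hv := by
    obtain ⟨e₀, rfl⟩ := hv
    rw [← f.sum_edges (g e₀.src) ⟨g.edge e₀, rfl⟩]
    refine Finset.sum_bij' (fun e _ => g.edge e) (fun e _ => (Digraph.Aut.edge g.symm e))
      ?_ ?_ ?_ ?_ ?_
    · intro e he
      simp only [Finset.mem_filter, Finset.mem_univ, true_and] at he ⊢
      exact congrArg g he
    · intro e he
      simp only [Finset.mem_filter, Finset.mem_univ, true_and] at he ⊢
      exact (congrArg g.symm he).trans (g.symm_apply_apply _)
    · intro e _
      exact Digraph.Edge.eq_of (g.symm_apply_apply _) (g.symm_apply_apply _)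
    · intro e _
      exact Digraph.Edge.eq_of (g.apply_symm_apply _) (g.apply_symm_apply _)
    · intro e _
      rfl
  sum_one := (Equiv.sum_comp g.toEquiv f.p).trans f.sum_one

end CKFamily

namespace GraphCStar

variable {V : Type u} [Fintype V] (G : Digraph V)

/-- The gauge action `γ_z` of the circle: `p v ↦ p v`, `S e ↦ z S e`. -/
def gauge (z : Circle) : GraphCStar G →⋆ₐ[ℂ] GraphCStar G := lift ((family G).rotate z)

/-- The dynamics `σ_t = γ_{exp (i t)}`. -/
def dynamics (t : ℝ) : GraphCStar G →⋆ₐ[ℂ] GraphCStar G := gauge G (Circle.exp t)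

variable {G}

/-- The action of graph automorphisms: `p v ↦ p (g v)`, `S e ↦ S (g e)`. -/
def autAction (g : G.Aut) : GraphCStar G →⋆ₐ[ℂ] GraphCStar G := lift ((family G).permute g)

end GraphCStar

/-! ### States and the KMS condition -/

/-- States of a unital C⋆-algebra: positive linear functionals taking the value one at the unit. -/
def IsState {A : Type u} [CStarAlgebra A] (τ : A →L[ℂ] ℂ) : Prop :=
  (∀ a, 0 ≤ τ (star a * a)) ∧ τ 1 = 1

/-- The function `F` is the entire extension `z ↦ σ_z(a)` of the orbit `t ↦ σ_t(a)`. It is unique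
if it exists; `a` is analytic when it does. -/
def IsEntireOrbit {A : Type u} [CStarAlgebra A] (σ : ℝ → A →⋆ₐ[ℂ] A) (a : A) (F : ℂ → A) : Prop :=
  Differentiable ℂ F ∧ ∀ t : ℝ, F t = σ t a

/-- KMS states at inverse temperature `β` of the dynamics `σ`: states with
`τ(ab) = τ(b σ_{iβ}(a))` for all analytic elements `a` and `b`. -/
def IsKMSState {A : Type u} [CStarAlgebra A] (σ : ℝ → A →⋆ₐ[ℂ] A) (β : ℝ) (τ : A →L[ℂ] ℂ) : Prop :=
  IsState τ ∧ ∀ (a b : A) (F H : ℂ → A), IsEntireOrbit σ a F → IsEntireOrbit σ b H →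
    τ (a * b) = τ (b * F (Complex.I * β))

end

/-! ### Spectral radius of a disjoint union -/

/-! At inverse temperature `log lam` the KMS condition gives τ(S_e S_e⋆) = λ⁻¹ τ(p_{t(e)}). Summed
over the edges leaving a vertex, this says that v ↦ τ(p_v) is a nonnegative eigenvector of the
vertex matrix for λ (`IsKMSState.isEigenvector`). Conversely every normalized nonnegative
eigenvector arises in this way (`GraphCStar.exists_isKMSState`). The vertex matrix of the union is
block diagonal, so its spectral radius is the maximum of the two radii. If x and y are the positive
normalized Perron–Frobenius eigenvectors of the two blocks, the segment s x ⊕ (1 - s) y yields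
infinitely many KMS states.

For existence, a state with vertex values x is built from vector states of a concrete Cuntz–Krieger
family. The transfer operator φ ↦ λ⁻¹ ∑ φ(S_e⋆ · S_e) preserves the set of such states, and a weak-⋆
limit of Cesàro means along its orbit is a fixed point. Fixed points satisfy the KMS relation
against the generators, hence against a total set of homogeneous elements. It extends to all
analytic elements by comparing Fourier coefficients of τ(σ_t(a) b) with those of the entire
extension of τ(b σ_t(a)), shifted to the line Im z = β (`GraphCStar.isKMSState_of_dense`).

An automorphism of the union preserves both parts, since otherwise it would restrict to an
isomorphism between them (`aut_inl`); this gives the product decomposition. On each part a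
nonnegative eigenvector is invariant under automorphisms. For λ ≠ 1 a KMS state is determined by its
vertex values (`IsKMSState.ext_of_apply_p`), so it is invariant.

At λ = 1, that is β = 0, this determination fails: a single loop already has algebra C(𝕋), on which
every state is KMS. But then every vertex has exactly one neighbour, each part being a looped vertex
or a single edge. Automorphisms act as conjugation by a unitary that is a sum of generators, and τ
commutes with generators. The value λ = 0 does not occur, since both graphs would be single vertices
without loops, hence isomorphic. -/

theorem UndirectedGraph.vertexMatrix_disjUnion {V : Type u} {W : Type v} (Γ : UndirectedGraph V)
    (Λ : UndirectedGraph W) :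
    (Γ.disjUnion Λ).directed.vertexMatrix =
      Matrix.fromBlocks Γ.directed.vertexMatrix 0 0 Λ.directed.vertexMatrix := by
  classical
  ext (i | i) (j | j)
  · exact if_congr Sum.liftRel_inl_inl rfl rfl
  · exact if_neg Sum.not_liftRel_inl_inr
  · exact if_neg Sum.not_liftRel_inr_inl
  · exact if_congr Sum.liftRel_inr_inr rfl rfl

theorem Matrix.spectrum_fromBlocks_diagonal {m : Type u} {n : Type v} [Fintype m] [DecidableEq m]
    [Fintype n] [DecidableEq n] (A : Matrix m m ℂ) (B : Matrix n n ℂ) :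
    spectrum ℂ (Matrix.fromBlocks A 0 0 B) = spectrum ℂ A ∪ spectrum ℂ B := by
  ext z
  have h : algebraMap ℂ (Matrix (m ⊕ n) (m ⊕ n) ℂ) z - Matrix.fromBlocks A 0 0 B =
      Matrix.fromBlocks (algebraMap ℂ _ z - A) 0 0 (algebraMap ℂ _ z - B) := by
    ext (i | i) (j | j) <;> simp [Matrix.algebraMap_matrix_apply]
  rw [Set.mem_union, spectrum.mem_iff, spectrum.mem_iff, spectrum.mem_iff, h,
    Matrix.isUnit_fromBlocks_zero₂₁, not_and_or]

theorem UndirectedGraph.spectralRadius_disjUnion {V : Type u} {W : Type v} [Fintype V]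
    [DecidableEq V] [Fintype W] [DecidableEq W] (Γ : UndirectedGraph V) (Λ : UndirectedGraph W) :
    spectralRadius ℂ (Γ.disjUnion Λ).directed.vertexMatrix =
      spectralRadius ℂ Γ.directed.vertexMatrix ⊔ spectralRadius ℂ Λ.directed.vertexMatrix := by
  simp only [spectralRadius, vertexMatrix_disjUnion, Matrix.spectrum_fromBlocks_diagonal,
    iSup_union]

/-! ### Perron–Frobenius theory of undirected graphs -/

/-- Real eigenvectors of the vertex matrix. -/
def Digraph.IsEigenvector {V : Type u} [Fintype V] (G : Digraph V) (lam : ℝ) (x : V → ℝ) : Prop :=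
  open scoped Classical in ∀ v, ∑ w, (if G.Adj v w then x w else 0) = lam * x v

theorem Digraph.IsEigenvector.const_mul {V : Type u} [Fintype V] {G : Digraph V} {lam : ℝ}
    {x : V → ℝ} (hx : G.IsEigenvector lam x) (c : ℝ) : G.IsEigenvector lam fun v => c * x v := by
  intro v
  rw [mul_left_comm, ← hx v, Finset.mul_sum]
  exact Finset.sum_congr rfl fun w _ => by split_ifs <;> simp

section PerronFrobenius

variable {V : Type u} [Fintype V] {Γ : UndirectedGraph V}

-- The vertex matrix is real symmetric, hence self-adjoint. This replaces the spectral radius by the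
-- ℓ² operator norm, which yields inequalities.
open scoped Matrix.Norms.L2Operator in
theorem UndirectedGraph.spectralRadius_eq_norm [DecidableEq V] (Γ : UndirectedGraph V) :
    spectralRadius ℂ Γ.directed.vertexMatrix = ‖Γ.directed.vertexMatrix‖₊ := by
  refine IsSelfAdjoint.spectralRadius_eq_nnnorm ?_
  ext v w
  have h : Γ.directed.Adj w v ↔ Γ.directed.Adj v w := ⟨Γ.symm _ _, Γ.symm _ _⟩
  simp only [Digraph.vertexMatrix, Matrix.star_apply, Matrix.of_apply]
  split_ifs <;> simp_all

-- The operator norm vanishes, so the matrix does. This serves to exclude λ = 0.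
open scoped Matrix.Norms.L2Operator in
theorem UndirectedGraph.not_adj_of_spectralRadius_eq_zero
    [DecidableEq V] (h : spectralRadius ℂ Γ.directed.vertexMatrix = 0) (v w : V) : ¬ Γ.Adj v w := by
  rw [Γ.spectralRadius_eq_norm, ENNReal.coe_eq_zero, nnnorm_eq_zero] at h
  intro hvw
  have := congrFun (congrFun h v) w
  simp [Digraph.vertexMatrix, UndirectedGraph.directed, hvw] at this

open scoped Matrix.Norms.L2Operator in
theorem UndirectedGraph.sum_sq_le [DecidableEq V] {lam : ℝ≥0}
    (h : spectralRadius ℂ Γ.directed.vertexMatrix = lam) (y : V → ℂ) :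
    ∑ v, ‖Γ.directed.vertexMatrix.mulVec y v‖ ^ 2 ≤ lam ^ 2 * ∑ v, ‖y v‖ ^ 2 := by
  rw [Γ.spectralRadius_eq_norm, ENNReal.coe_inj] at h
  have h1 := Matrix.l2_opNorm_mulVec Γ.directed.vertexMatrix (WithLp.toLp 2 y)
  rw [show ‖Γ.directed.vertexMatrix‖ = lam from congrArg NNReal.toReal h] at h1
  have h2 := pow_le_pow_left₀ (norm_nonneg _) h1 2
  rw [mul_pow, EuclideanSpace.norm_sq_eq, EuclideanSpace.norm_sq_eq] at h2
  exact h2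

/-- The spectral radius of an undirected graph has a nonnegative eigenvector. -/
theorem UndirectedGraph.exists_nonneg_eigenvector [DecidableEq V] [Nonempty V] {lam : ℝ≥0}
    (h : spectralRadius ℂ Γ.directed.vertexMatrix = lam) :
    ∃ x : V → ℝ, (∀ v, 0 ≤ x v) ∧ (∃ v, x v ≠ 0) ∧ Γ.directed.IsEigenvector lam x := by
  classical
  obtain ⟨z, hz, hzl⟩ : ∃ z ∈ spectrum ℂ Γ.directed.vertexMatrix, (‖z‖₊ : ℝ≥0∞) = lam := by
    open scoped Matrix.Norms.L2Operator in
    obtain ⟨z, hz, hz'⟩ := spectrum.exists_nnnorm_eq_spectralRadius Γ.directed.vertexMatrix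
    exact ⟨z, hz, hz'.trans h⟩
  have hzl : ‖z‖ = lam := congrArg NNReal.toReal (ENNReal.coe_inj.1 hzl)
  rw [← Matrix.spectrum_toLin', ← Module.End.hasEigenvalue_iff_mem_spectrum] at hz
  obtain ⟨y, hy⟩ := hz.exists_hasEigenvector
  have hy1 : Γ.directed.vertexMatrix.mulVec y = z • y := by
    simpa using hy.apply_eq_smul
  have hmul : ∀ (f : V → ℂ) v, Γ.directed.vertexMatrix.mulVec f v =
      ∑ w, if Γ.Adj v w then f w else 0 := by
    intro f v
    refine Finset.sum_congr rfl fun w _ => ?_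
    change (if Γ.Adj v w then (1 : ℂ) else 0) * f w = _
    split_ifs <;> simp
  -- The moduli of an eigenvector `y` for an eigenvalue `z` of maximal modulus. The triangle
  -- inequality gives λ x ≤ D x pointwise, the operator norm gives ‖D x‖ ≤ λ ‖x‖, and together they
  -- force D x = λ x.
  let x : V → ℝ := fun v => ‖y v‖
  let s : V → ℝ := fun v => ∑ w, if Γ.Adj v w then x w else 0
  have hs : ∀ v, lam * x v ≤ s v := by
    intro v
    have h1 := congrArg norm (congrFun hy1 v)
    rw [hmul, Pi.smul_apply, smul_eq_mul, norm_mul, hzl] at h1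
    rw [← h1]
    refine (norm_sum_le _ _).trans (Finset.sum_le_sum fun w _ => ?_)
    split_ifs <;> simp [x]
  have hsq : ∑ v, s v ^ 2 ≤ ∑ v, (lam * x v) ^ 2 := by
    have h1 := Γ.sum_sq_le h (fun v => (x v : ℂ))
    rw [Finset.mul_sum] at h1
    refine le_trans (le_of_eq ?_) (h1.trans (le_of_eq ?_))
    · refine Finset.sum_congr rfl fun v _ => ?_
      have h2 : Γ.directed.vertexMatrix.mulVec (fun v => (x v : ℂ)) v = ((s v : ℝ) : ℂ) := by
        rw [hmul]
        push_cast [s]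
        exact Finset.sum_congr rfl fun w _ => by split_ifs <;> simp
      rw [h2, Complex.norm_real, Real.norm_eq_abs, sq_abs]
    · refine Finset.sum_congr rfl fun v _ => ?_
      rw [Complex.norm_real, Real.norm_eq_abs, sq_abs, mul_pow]
  have hx0 : ∀ v, 0 ≤ x v := fun v => norm_nonneg _
  have hle : ∀ v ∈ Finset.univ, (lam * x v) ^ 2 ≤ s v ^ 2 := fun v _ =>
    pow_le_pow_left₀ (mul_nonneg lam.2 (hx0 v)) (hs v) 2
  have heq := (Finset.sum_eq_sum_iff_of_le hle).1 (le_antisymm (Finset.sum_le_sum hle) hsq)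
  refine ⟨x, hx0, ?_, fun v => ?_⟩
  · by_contra! hcon
    exact hy.2 (funext fun v => norm_eq_zero.1 (hcon v))
  · have := heq v (Finset.mem_univ v)
    exact ((pow_left_inj₀ (mul_nonneg lam.2 (hx0 v))
      ((mul_nonneg lam.2 (hx0 v)).trans (hs v)) two_ne_zero).1 this).symm

/-- Zeros of nonnegative eigenvectors spread over connected graphs. -/
theorem UndirectedGraph.eigenvector_eq_zero (hconn : Γ.Connected) {lam : ℝ} {x : V → ℝ}
    (hx : ∀ v, 0 ≤ x v) (he : Γ.directed.IsEigenvector lam x) {v₀ : V} (h₀ : x v₀ = 0) (v : V) :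
    x v = 0 := by
  classical
  induction hconn.2 v₀ v with
  | refl => exact h₀
  | @tail b c _ hbc ih =>
    -- Where `x` vanishes, the eigenvalue equation says that a sum of nonnegative neighbouring
    -- values is zero, so each of them is.
    have h1 := he b
    rw [ih, mul_zero, Finset.sum_eq_zero_iff_of_nonneg] at h1
    · have := h1 c (Finset.mem_univ c)
      rwa [if_pos (show Γ.directed.Adj b c from hbc)] at this
    · intro w _
      split_ifs
      exacts [hx w, le_rfl]

/-- The spectral radius of a connected graph has a positive eigenvector. -/
theorem UndirectedGraph.exists_pos_eigenvector [DecidableEq V] (hconn : Γ.Connected) {lam : ℝ≥0}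
    (h : spectralRadius ℂ Γ.directed.vertexMatrix = lam) :
    ∃ x : V → ℝ, (∀ v, 0 < x v) ∧ ∑ v, x v = 1 ∧ Γ.directed.IsEigenvector lam x := by
  classical
  have := hconn.1
  obtain ⟨x, hx, ⟨v₀, hv₀⟩, he⟩ := exists_nonneg_eigenvector h
  have hpos : ∀ v, 0 < x v := fun v =>
    lt_of_le_of_ne (hx v) fun hv => hv₀ (eigenvector_eq_zero hconn hx he hv.symm v₀)
  have hsum : 0 < ∑ v, x v := Finset.sum_pos (fun v _ => hpos v) Finset.univ_nonempty
  refine ⟨fun v => (∑ v, x v)⁻¹ * x v, fun v => mul_pos (inv_pos.2 hsum) (hpos v), ?_,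
    he.const_mul _⟩
  rw [← Finset.mul_sum, inv_mul_cancel₀ (ne_of_gt hsum)]

/-- Nonnegative eigenvectors of connected graphs are invariant under automorphisms. -/
theorem UndirectedGraph.eigenvector_aut (hconn : Γ.Connected) {lam : ℝ} {x : V → ℝ}
    (hx : ∀ v, 0 ≤ x v) (he : Γ.directed.IsEigenvector lam x) (g : Γ.directed.Aut) (v : V) :
    x (g v) = x v := by
  classical
  by_cases h0 : ∃ v₀, x v₀ = 0
  · obtain ⟨v₀, h0⟩ := h0
    rw [eigenvector_eq_zero hconn hx he h0, eigenvector_eq_zero hconn hx he h0]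
  have hpos : ∀ v, 0 < x v := fun v => lt_of_le_of_ne (hx v) fun h => h0 ⟨v, h.symm⟩
  have := hconn.1
  have heg : Γ.directed.IsEigenvector lam fun v => x (g v) := by
    intro v
    refine Eq.trans ?_ (he (g v))
    refine Eq.trans ?_ (Equiv.sum_comp g.toEquiv _)
    exact Finset.sum_congr rfl fun w _ => if_congr g.map_rel_iff.symm rfl rfl
  -- With `c` the least ratio, x ∘ g - c x is a nonnegative eigenvector with a zero at `v₀`, so it
  -- vanishes identically. Since `g` permutes the vertices, both vectors have the same sum, and `c =
  -- 1`.
  obtain ⟨v₀, -, hv₀⟩ := Finset.exists_min_image Finset.univ (fun v => x (g v) / x v)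
    Finset.univ_nonempty
  set c := x (g v₀) / x v₀ with hc
  have hz : ∀ v, x (g v) - c * x v = 0 := by
    refine eigenvector_eq_zero hconn (lam := lam) (v₀ := v₀) (fun v => ?_) (fun v => ?_) ?_
    · have := hv₀ v (Finset.mem_univ v)
      rw [le_div_iff₀ (hpos v)] at this
      linarith
    · rw [mul_sub, ← heg v, mul_left_comm, ← he v, Finset.mul_sum, ← Finset.sum_sub_distrib]
      exact Finset.sum_congr rfl fun w _ => by split_ifs <;> simp
    · rw [hc, div_mul_cancel₀ _ (hpos v₀).ne', sub_self]
  have hsum : ∑ v, x (g v) = ∑ v, x v := Equiv.sum_comp g.toEquiv x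
  have hS : 0 < ∑ v, x v := Finset.sum_pos (fun v _ => hpos v) Finset.univ_nonempty
  have hc1 : c = 1 := by
    have h1 : ∑ v, x (g v) = c * ∑ v, x v := by
      rw [Finset.mul_sum]
      exact Finset.sum_congr rfl fun v _ => sub_eq_zero.1 (hz v)
    rw [hsum] at h1
    nlinarith
  have := hz v
  rw [hc1] at this
  linarith

/-- If a connected graph has a positive eigenvector with eigenvalue one, then every vertex has
exactly one neighbour. -/
theorem UndirectedGraph.existsUnique_adj_of_eigenvalue_one (hconn : Γ.Connected) {x : V → ℝ}
    (hx : ∀ v, 0 < x v) (he : Γ.directed.IsEigenvector 1 x) (v : V) : ∃! w, Γ.Adj v w := by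
  classical
  have := hconn.1
  -- For eigenvalue one a single neighbour's value is at most the value at the vertex. Values
  -- therefore never increase along edges, and starting at a minimum they are constant; the equation
  -- then counts neighbours.
  obtain ⟨v₀, -, hv₀⟩ := Finset.exists_min_image Finset.univ x Finset.univ_nonempty
  have hz : ∀ v, x v = x v₀ := by
    intro v
    induction hconn.2 v₀ v with
    | refl => rfl
    | @tail b c _ hbc ih =>
      refine le_antisymm ?_ (hv₀ c (Finset.mem_univ c))
      rw [← ih, ← one_mul (x b), ← he b]
      have := Finset.single_le_sum (f := fun w => if Γ.directed.Adj b w then x w else 0)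
        (fun w _ => by split_ifs; exacts [(hx w).le, le_rfl]) (Finset.mem_univ c)
      rwa [if_pos (show Γ.directed.Adj b c from hbc)] at this
  have h1 := he v
  simp only [hz, one_mul] at h1
  rw [← Finset.sum_filter, Finset.sum_const, nsmul_eq_mul, mul_eq_right₀ (hx v₀).ne',
    Nat.cast_eq_one, Finset.card_eq_one] at h1
  obtain ⟨w, hw⟩ := h1
  simp only [Finset.ext_iff, Finset.mem_filter, Finset.mem_univ, true_and,
    Finset.mem_singleton] at hw
  exact ⟨w, (hw w).2 rfl, fun w' h' => (hw w').1 h'⟩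

end PerronFrobenius

/-! ### Automorphisms of a disjoint union -/

namespace UndirectedGraph

variable {V : Type u} {W : Type v} {Γ : UndirectedGraph V} {Λ : UndirectedGraph W}

theorem reflTransGen_disjUnion_isLeft {a b : V ⊕ W}
    (h : Relation.ReflTransGen (Γ.disjUnion Λ).Adj a b) : a.isLeft = b.isLeft := by
  induction h with
  | refl => rfl
  | tail _ hbc ih =>
    rw [ih]
    rcases hbc with h | h <;> rfl

/-- Automorphisms map a connected part into one of the two parts. -/
theorem aut_isLeft_inl (h : Γ.Connected) (g : (Γ.disjUnion Λ).directed.Aut) (v w : V) :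
    (g (Sum.inl v)).isLeft = (g (Sum.inl w)).isLeft := by
  exact reflTransGen_disjUnion_isLeft (Γ := Γ) (Λ := Λ)
    (Relation.ReflTransGen.lift (fun v => g (Sum.inl v))
      (fun a b hab => g.map_rel_iff.2 (Sum.LiftRel.inl hab)) _ _ (h.2 v w))

theorem aut_isLeft_inr (h : Λ.Connected) (g : (Γ.disjUnion Λ).directed.Aut) (v w : W) :
    (g (Sum.inr v)).isLeft = (g (Sum.inr w)).isLeft := by
  exact reflTransGen_disjUnion_isLeft (Γ := Γ) (Λ := Λ)
    (Relation.ReflTransGen.lift (fun v => g (Sum.inr v))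
      (fun a b hab => g.map_rel_iff.2 (Sum.LiftRel.inr hab)) _ _ (h.2 v w))

/-- If one vertex of `Γ` lands in `Λ`, connectedness sends all of `Γ` there. The inverse sends one
vertex of `Λ`, hence all of `Λ`, back into `Γ`, so `g` restricts to a forbidden isomorphism. -/
theorem aut_inl (h₁ : Γ.Connected) (h₂ : Λ.Connected) (hiso : IsEmpty (Γ.Iso Λ))
    (g : (Γ.disjUnion Λ).directed.Aut) (v : V) : ∃ w, g (Sum.inl v) = Sum.inl w := by
  rcases hg : g (Sum.inl v) with w | w
  · exact ⟨w, rfl⟩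
  exfalso
  have hf : ∀ v', ∃ w', g (Sum.inl v') = Sum.inr w' := by
    intro v'
    have := aut_isLeft_inl h₁ g v' v
    rw [hg] at this
    rcases hg' : g (Sum.inl v') with w' | w'
    · rw [hg'] at this
      cases this
    · exact ⟨w', rfl⟩
  have hb : ∀ w', ∃ v', g.symm (Sum.inr w') = Sum.inl v' := by
    intro w'
    have := aut_isLeft_inr h₂ g.symm w' w
    rw [← hg, g.symm_apply_apply] at this
    rcases hg' : g.symm (Sum.inr w') with v' | v'
    · exact ⟨v', rfl⟩
    · rw [hg'] at this
      cases this
  choose f hf using hf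
  choose b hb using hb
  refine hiso.false (RelIso.mk ⟨f, b, fun v => ?_, fun w => ?_⟩ ?_)
  · rw [← Sum.inl_injective.eq_iff (a := b (f v)), ← hb, ← hf, g.symm_apply_apply]
  · rw [← Sum.inr_injective.eq_iff (a := f (b w)), ← hf, ← hb, g.apply_symm_apply]
  · intro v w
    have : (Γ.disjUnion Λ).Adj (g (Sum.inl v)) (g (Sum.inl w)) ↔
        (Γ.disjUnion Λ).Adj (Sum.inl v) (Sum.inl w) := g.map_rel_iff
    rw [hf, hf] at this
    exact (Sum.liftRel_inr_inr.symm.trans this).trans Sum.liftRel_inl_inl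

theorem aut_inr (h₁ : Γ.Connected) (h₂ : Λ.Connected) (hiso : IsEmpty (Γ.Iso Λ))
    (g : (Γ.disjUnion Λ).directed.Aut) (w : W) : ∃ z, g (Sum.inr w) = Sum.inr z := by
  rcases hg : g (Sum.inr w) with v | z
  · obtain ⟨u, hu⟩ := aut_inl h₁ h₂ hiso g.symm v
    rw [← hg, g.symm_apply_apply] at hu
    cases hu
  · exact ⟨z, rfl⟩

/-- The automorphism of a disjoint union given by automorphisms of the two parts. -/
def autSum (g : Γ.directed.Aut × Λ.directed.Aut) : (Γ.disjUnion Λ).directed.Aut where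
  toEquiv := Equiv.sumCongr g.1.toEquiv g.2.toEquiv
  map_rel_iff' := by
    rintro (v | v) (w | w)
    · exact Sum.liftRel_inl_inl.trans (g.1.map_rel_iff.trans Sum.liftRel_inl_inl.symm)
    · exact iff_of_false Sum.not_liftRel_inl_inr Sum.not_liftRel_inl_inr
    · exact iff_of_false Sum.not_liftRel_inr_inl Sum.not_liftRel_inr_inl
    · exact Sum.liftRel_inr_inr.trans (g.2.map_rel_iff.trans Sum.liftRel_inr_inr.symm)

/-- Automorphisms of the union of non-isomorphic connected graphs preserve the two parts. -/
theorem exists_autSum (h₁ : Γ.Connected) (h₂ : Λ.Connected) (hiso : IsEmpty (Γ.Iso Λ))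
    (g : (Γ.disjUnion Λ).directed.Aut) : ∃ k, autSum k = g := by
  choose f hf using aut_inl h₁ h₂ hiso g
  choose f' hf' using aut_inl h₁ h₂ hiso g.symm
  choose k hk using aut_inr h₁ h₂ hiso g
  choose k' hk' using aut_inr h₁ h₂ hiso g.symm
  refine ⟨(RelIso.mk ⟨f, f', fun v => ?_, fun v => ?_⟩ ?_,
    RelIso.mk ⟨k, k', fun v => ?_, fun v => ?_⟩ ?_), ?_⟩
  · exact Sum.inl_injective ((hf' _).symm.trans (by rw [← hf, g.symm_apply_apply]))
  · exact Sum.inl_injective ((hf _).symm.trans (by rw [← hf', g.apply_symm_apply]))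
  · intro v w
    have : (Γ.disjUnion Λ).Adj (g (Sum.inl v)) (g (Sum.inl w)) ↔
        (Γ.disjUnion Λ).Adj (Sum.inl v) (Sum.inl w) := g.map_rel_iff
    rw [hf, hf] at this
    exact (Sum.liftRel_inl_inl.symm.trans this).trans Sum.liftRel_inl_inl
  · exact Sum.inr_injective ((hk' _).symm.trans (by rw [← hk, g.symm_apply_apply]))
  · exact Sum.inr_injective ((hk _).symm.trans (by rw [← hk', g.apply_symm_apply]))
  · intro v w
    have : (Γ.disjUnion Λ).Adj (g (Sum.inr v)) (g (Sum.inr w)) ↔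
        (Γ.disjUnion Λ).Adj (Sum.inr v) (Sum.inr w) := g.map_rel_iff
    rw [hk, hk] at this
    exact (Sum.liftRel_inr_inr.symm.trans this).trans Sum.liftRel_inr_inr
  · ext (v | v)
    · exact (hf v).symm
    · exact (hk v).symm

theorem exists_autSum_mulEquiv (h₁ : Γ.Connected) (h₂ : Λ.Connected)
    (hiso : IsEmpty (Γ.Iso Λ)) :
    ∃ Φ : Γ.directed.Aut × Λ.directed.Aut ≃* (Γ.disjUnion Λ).directed.Aut,
      ∀ g, Φ g = autSum g := by
  refine ⟨MulEquiv.ofBijective (MonoidHom.mk' autSum ?_) ⟨?_, exists_autSum h₁ h₂ hiso⟩,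
    fun g => rfl⟩
  · intro g k
    ext (v | v) <;> rfl
  · intro g k hgk
    refine Prod.ext (RelIso.ext fun v => ?_) (RelIso.ext fun w => ?_)
    · exact Sum.inl_injective (congrArg (fun f => f (Sum.inl v)) hgk)
    · exact Sum.inr_injective (congrArg (fun f => f (Sum.inr w)) hgk)

/-! ### Eigenvectors of a disjoint union -/

/-- No edge joins the two parts, so the eigenvalue equations decouple. -/
theorem isEigenvector_disjUnion [Fintype V] [Fintype W] {lam : ℝ} {x : V ⊕ W → ℝ} :
    (Γ.disjUnion Λ).directed.IsEigenvector lam x ↔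
      Γ.directed.IsEigenvector lam (fun v => x (Sum.inl v)) ∧
        Λ.directed.IsEigenvector lam (fun w => x (Sum.inr w)) := by
  classical
  have h1 : ∀ v, ∑ w, (if (Γ.disjUnion Λ).directed.Adj (Sum.inl v) w then x w else 0) =
      ∑ w, if Γ.directed.Adj v w then x (Sum.inl w) else 0 := by
    intro v
    rw [Fintype.sum_sum_type, Finset.sum_eq_zero (s := (Finset.univ : Finset W)), add_zero]
    · exact Finset.sum_congr rfl fun w _ => if_congr Sum.liftRel_inl_inl rfl rfl
    · exact fun w _ => if_neg Sum.not_liftRel_inl_inr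
  have h2 : ∀ v, ∑ w, (if (Γ.disjUnion Λ).directed.Adj (Sum.inr v) w then x w else 0) =
      ∑ w, if Λ.directed.Adj v w then x (Sum.inr w) else 0 := by
    intro v
    rw [Fintype.sum_sum_type, Finset.sum_eq_zero (s := (Finset.univ : Finset V)), zero_add]
    · exact Finset.sum_congr rfl fun w _ => if_congr Sum.liftRel_inr_inr rfl rfl
    · exact fun w _ => if_neg Sum.not_liftRel_inr_inl
  refine Sum.forall.trans (and_congr (forall_congr' fun v => ?_) (forall_congr' fun v => ?_))
  · exact Eq.congr_left (h1 v)
  · exact Eq.congr_left (h2 v)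

end UndirectedGraph

/-! ### Relations in Cuntz–Krieger families -/

namespace CKFamily

variable {V : Type u} [Fintype V] {G : Digraph V} {A : Type v} [CStarAlgebra A]

theorem p_mul_self (f : CKFamily G A) (v : V) : f.p v * f.p v = f.p v :=
  (f.p_proj v).isIdempotentElem.eq

theorem star_p (f : CKFamily G A) (v : V) : star (f.p v) = f.p v :=
  (f.p_proj v).isSelfAdjoint.star_eq

/-- By the C⋆-identity it is enough that (S p - S)⋆(S p - S) = 0, and its four terms are ±p and
cancel. -/
theorem S_mul_p (f : CKFamily G A) (e : G.Edge) : f.S e * f.p e.tgt = f.S e := by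
  have h : ∀ a : A, star (f.S e) * (f.S e * a) = f.p e.tgt * a := fun a => by
    rw [← mul_assoc, f.star_mul_self]
  rw [← sub_eq_zero, ← CStarRing.star_mul_self_eq_zero_iff]
  simp only [star_sub, star_mul, star_p, sub_mul, mul_sub, f.star_mul_self, mul_assoc, h,
    p_mul_self, sub_self]

theorem p_mul_star_S (f : CKFamily G A) (e : G.Edge) :
    f.p e.tgt * star (f.S e) = star (f.S e) := by
  rw [← star_p, ← star_mul, S_mul_p]

/-- The range of `S e` lies below `p e.src` and is orthogonal to the ranges of the other `S f`. -/
theorem range_S (f : CKFamily G A) (e : G.Edge) :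
    f.p e.src * f.S e = f.S e ∧
      ∀ e' : G.Edge, e'.src = e.src → e' ≠ e → star (f.S e') * f.S e = 0 := by
  classical
  let _ : PartialOrder A := CStarAlgebra.spectralOrder A
  have _ : StarOrderedRing A := CStarAlgebra.spectralOrderedRing A
  let d := f.S e - f.p e.src * f.S e
  let T := (Finset.univ.filter fun e' : G.Edge => e'.src = e.src).erase e
  have hd : star d * d = f.p e.tgt - star (f.S e) * (f.p e.src * f.S e) := by
    simp only [d, star_sub, star_mul, star_p, sub_mul, mul_sub, f.star_mul_self, mul_assoc]
    rw [← mul_assoc (f.p e.src) (f.p e.src), p_mul_self]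
    abel
  -- Multiplying the Cuntz–Krieger sum by S_e⋆ on the left and S_e on the right gives S_e⋆ p S_e =
  -- p_{t(e)} plus positive terms, while d⋆d is p_{t(e)} - S_e⋆ p S_e. The positive elements thus
  -- add up to zero, and each one vanishes.
  have hsum : star d * d +
      ∑ e' ∈ T, star (star (f.S e') * f.S e) * (star (f.S e') * f.S e) = 0 := by
    have h1 : star (f.S e) * (f.p e.src * f.S e) = f.p e.tgt +
        ∑ e' ∈ T, star (star (f.S e') * f.S e) * (star (f.S e') * f.S e) := by
      rw [← f.sum_edges e.src ⟨e, rfl⟩, Finset.sum_mul, Finset.mul_sum,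
        ← Finset.add_sum_erase _ _ (show e ∈ Finset.univ.filter fun e' : G.Edge =>
          e'.src = e.src by simp)]
      congr 1
      · rw [mul_assoc, f.star_mul_self, S_mul_p, f.star_mul_self]
      · exact Finset.sum_congr rfl fun e' _ => by simp only [star_mul, star_star, mul_assoc]
    rw [hd, h1]
    abel
  have hnn : ∀ e' ∈ T, 0 ≤ star (star (f.S e') * f.S e) * (star (f.S e') * f.S e) :=
    fun e' _ => star_mul_self_nonneg _
  rw [add_eq_zero_iff_of_nonneg (star_mul_self_nonneg d) (Finset.sum_nonneg hnn),
    Finset.sum_eq_zero_iff_of_nonneg hnn] at hsum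
  refine ⟨(sub_eq_zero.1 ((CStarRing.star_mul_self_eq_zero_iff d).1 hsum.1)).symm,
    fun e' h he => ?_⟩
  refine (CStarRing.star_mul_self_eq_zero_iff _).1 (hsum.2 e' ?_)
  simp [T, h, he]

theorem p_mul_S (f : CKFamily G A) (e : G.Edge) : f.p e.src * f.S e = f.S e := (f.range_S e).1

theorem star_S_mul_p (f : CKFamily G A) (e : G.Edge) :
    star (f.S e) * f.p e.src = star (f.S e) := by
  rw [← star_p, ← star_mul, p_mul_S]

theorem p_mul_S_of_ne (f : CKFamily G A) {e : G.Edge} {v : V} (h : e.src ≠ v) :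
    f.p v * f.S e = 0 := by
  rw [← p_mul_S, ← mul_assoc, f.p_orth _ _ h.symm, zero_mul]

theorem star_S_mul_p_of_ne (f : CKFamily G A) {e : G.Edge} {v : V} (h : e.src ≠ v) :
    star (f.S e) * f.p v = 0 := by
  rw [← star_S_mul_p, mul_assoc, f.p_orth _ _ h, mul_zero]

theorem star_S_mul_S_of_ne (f : CKFamily G A) {e e' : G.Edge} (h : e' ≠ e) :
    star (f.S e') * f.S e = 0 := by
  by_cases hs : e'.src = e.src
  · exact (f.range_S e).2 e' hs h
  · rw [← star_S_mul_p, mul_assoc, p_mul_S_of_ne _ (Ne.symm hs), mul_zero]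

end CKFamily

namespace GraphCStar

variable {V : Type u} [Fintype V] {G : Digraph V}

/-! ### Dense subspaces -/

theorem ofHom_mono_mem {N : Submodule ℂ (GraphCStar G)} (one : 1 ∈ N)
    (p_mul : ∀ v, ∀ a ∈ N, (family G).p v * a ∈ N)
    (S_mul : ∀ e, ∀ a ∈ N, (family G).S e * a ∈ N)
    (star_S_mul : ∀ e, ∀ a ∈ N, star ((family G).S e) * a ∈ N)
    (w : FreeMonoid ((V ⊕ G.Edge) × Bool)) : ofHom (G := G) (FreeStarAlg.mono w 1) ∈ N := by
  induction w using FreeMonoid.inductionOn' with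
  | one =>
    have : ofHom (G := G) (FreeStarAlg.mono 1 1) = 1 := map_one ofHom
    rwa [this]
  | of_mul x w ih =>
    have h1 : (FreeStarAlg.mono (FreeMonoid.of x * w) 1 : FreeStarAlg (V ⊕ G.Edge)) =
        FreeStarAlg.mono (FreeMonoid.of x) 1 * FreeStarAlg.mono w 1 := by
      rw [FreeStarAlg.mono_mul, mul_one]
    have h2 : ofHom (G := G) (FreeStarAlg.mono (FreeMonoid.of x * w) 1) =
        ofHom (G := G) (FreeStarAlg.mono (FreeMonoid.of x) 1) *
          ofHom (G := G) (FreeStarAlg.mono w 1) := by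
      rw [h1]
      exact map_mul ofHom _ _
    rw [h2]
    obtain ⟨x, _ | _⟩ := x
    · rcases x with v | e
      · exact p_mul v _ ih
      · exact S_mul e _ ih
    · have h3 : ofHom (G := G) (FreeStarAlg.mono (FreeMonoid.of (x, true)) 1) =
          star (ofHom (G := G) (FreeStarAlg.gen x)) := by
        rw [← FreeStarAlg.star_gen]
        exact map_star ofHom _
      rw [h3]
      rcases x with v | e
      · have : star (ofHom (G := G) (FreeStarAlg.gen (Sum.inl v))) = (family G).p v :=
          (family G).star_p v
        rw [this]
        exact p_mul v _ ih
      · exact star_S_mul e _ ih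

/-- A subspace which contains the unit and is stable under left multiplication by the generators
and their adjoints is dense. -/
theorem dense_of_mul_mem {N : Submodule ℂ (GraphCStar G)} (one : 1 ∈ N)
    (p_mul : ∀ v, ∀ a ∈ N, (family G).p v * a ∈ N)
    (S_mul : ∀ e, ∀ a ∈ N, (family G).S e * a ∈ N)
    (star_S_mul : ∀ e, ∀ a ∈ N, star ((family G).S e) * a ∈ N) :
    Dense (N : Set (GraphCStar G)) := by
  refine dense_of.mono ?_
  rintro _ ⟨a, rfl⟩
  change ofHom a ∈ N
  induction a using FreeStarAlg.ind with
  | zero =>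
    have : ofHom (G := G) 0 = 0 := map_zero ofHom
    exact this ▸ N.zero_mem
  | add a b ha hb =>
    have : ofHom (G := G) (a + b) = ofHom (G := G) a + ofHom (G := G) b := map_add ofHom a b
    exact this ▸ N.add_mem ha hb
  | mono w c =>
    have h1 : (FreeStarAlg.mono w c : FreeStarAlg (V ⊕ G.Edge)) = c • FreeStarAlg.mono w 1 := by
      rw [FreeStarAlg.smul_mono, mul_one]
    rw [h1]
    have : ofHom (G := G) (c • FreeStarAlg.mono w 1) = c • ofHom (G := G) (FreeStarAlg.mono w 1) :=
      map_smul ofHom c _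
    exact this ▸ N.smul_mem c (ofHom_mono_mem one p_mul S_mul star_S_mul w)

theorem dense_span_of_mul_mem {s : Set (GraphCStar G)} (one : 1 ∈ Submodule.span ℂ s)
    (p_mul : ∀ v, ∀ a ∈ s, (family G).p v * a ∈ Submodule.span ℂ s)
    (S_mul : ∀ e, ∀ a ∈ s, (family G).S e * a ∈ Submodule.span ℂ s)
    (star_S_mul : ∀ e, ∀ a ∈ s, star ((family G).S e) * a ∈ Submodule.span ℂ s) :
    Dense (Submodule.span ℂ s : Set (GraphCStar G)) := by
  have key : ∀ x : GraphCStar G, (∀ a ∈ s, x * a ∈ Submodule.span ℂ s) →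
      ∀ a ∈ Submodule.span ℂ s, x * a ∈ Submodule.span ℂ s := by
    intro x hx a ha
    induction ha using Submodule.span_induction with
    | mem a ha => exact hx a ha
    | zero => rw [mul_zero]; exact Submodule.zero_mem _
    | add a b _ _ ha hb => rw [mul_add]; exact Submodule.add_mem _ ha hb
    | smul c a _ ha => rw [mul_smul_comm]; exact Submodule.smul_mem _ c ha
  exact dense_of_mul_mem one (fun v => key _ (p_mul v)) (fun e => key _ (S_mul e))
    (fun e => key _ (star_S_mul e))

/-! ### Homogeneous elements -/

theorem dynamics_p (t : ℝ) (v : V) : dynamics G t ((family G).p v) = (family G).p v :=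
  lift_p _ v

theorem dynamics_S (t : ℝ) (e : G.Edge) :
    dynamics G t ((family G).S e) = (Circle.exp t : ℂ) • (family G).S e := lift_S _ e

/-- Homogeneous elements of degree `d` for the gauge action. -/
def IsHomogeneous (a : GraphCStar G) (d : ℤ) : Prop :=
  ∀ t : ℝ, dynamics G t a = Complex.exp (d * t * Complex.I) • a

theorem IsHomogeneous.one : IsHomogeneous (1 : GraphCStar G) 0 := fun t => by simp

theorem isHomogeneous_p (v : V) : IsHomogeneous ((family G).p v) 0 := fun t => by
  simp [dynamics_p]

theorem isHomogeneous_S (e : G.Edge) : IsHomogeneous ((family G).S e) 1 := fun t => by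
  simp [dynamics_S]

theorem IsHomogeneous.mul {a b : GraphCStar G} {d d' : ℤ} (ha : IsHomogeneous a d)
    (hb : IsHomogeneous b d') : IsHomogeneous (a * b) (d + d') := fun t => by
  rw [map_mul, ha, hb, smul_mul_smul_comm, ← Complex.exp_add]
  push_cast
  ring_nf

theorem IsHomogeneous.star {a : GraphCStar G} {d : ℤ} (ha : IsHomogeneous a d) :
    IsHomogeneous (star a) (-d) := fun t => by
  rw [map_star, ha, star_smul]
  congr 1
  change (starRingEnd ℂ) _ = _
  rw [← Complex.exp_conj]
  simp

theorem IsHomogeneous.isEntireOrbit {a : GraphCStar G} {d : ℤ} (ha : IsHomogeneous a d) :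
    IsEntireOrbit (dynamics G) a (fun z => Complex.exp (d * z * Complex.I) • a) := by
  refine ⟨?_, fun t => (ha t).symm⟩
  fun_prop

/-- Generators and their adjoints are homogeneous and degrees add. As homogeneous elements are
analytic, continuous identities can be tested on elements to which the KMS condition applies. -/
theorem dense_span_isHomogeneous :
    Dense (Submodule.span ℂ {a : GraphCStar G | ∃ d, IsHomogeneous a d} :
      Set (GraphCStar G)) := by
  refine dense_span_of_mul_mem (Submodule.subset_span ⟨0, .one⟩) ?_ ?_ ?_
  · rintro v a ⟨d, ha⟩
    exact Submodule.subset_span ⟨_, (isHomogeneous_p v).mul ha⟩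
  · rintro e a ⟨d, ha⟩
    exact Submodule.subset_span ⟨_, (isHomogeneous_S e).mul ha⟩
  · rintro e a ⟨d, ha⟩
    exact Submodule.subset_span ⟨_, (isHomogeneous_S e).star.mul ha⟩

theorem norm_dynamics_le (t : ℝ) (a : GraphCStar G) : ‖dynamics G t a‖ ≤ ‖a‖ :=
  NonUnitalStarAlgHom.norm_apply_le (dynamics G t) a

/-- The dynamics is jointly continuous. -/
theorem continuous_dynamics :
    Continuous fun x : GraphCStar G × ℝ => dynamics G x.2 x.1 := by
  -- Each σ_t is contractive, so continuity in `t` is needed only on a dense subspace, where the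
  -- orbits are finite sums of exponentials.
  refine continuous_prod_of_dense_continuous_lipschitzWith _ 1 dense_span_isHomogeneous ?_ ?_
  · intro a ha
    dsimp only
    induction ha using Submodule.span_induction with
    | mem a ha =>
      obtain ⟨d, ha⟩ := ha
      simp_rw [ha _]
      fun_prop
    | zero => simpa using continuous_const
    | add a b _ _ ha hb =>
      simp_rw [map_add]
      exact ha.add hb
    | smul c a _ ha =>
      simp_rw [map_smul]
      exact ha.const_smul c
  · intro t
    refine LipschitzWith.of_dist_le_mul fun a b => ?_
    rw [dist_eq_norm, dist_eq_norm, ← map_sub, NNReal.coe_one, one_mul]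
    exact norm_dynamics_le t _

/-- The KMS condition for a homogeneous element. -/
theorem _root_.IsKMSState.apply_homogeneous_mul {β : ℝ} {τ : GraphCStar G →L[ℂ] ℂ}
    (hτ : IsKMSState (dynamics G) β τ) {a : GraphCStar G} {d : ℤ} (ha : IsHomogeneous a d)
    (b : GraphCStar G) : τ (a * b) = Complex.exp (-(d * β)) * τ (b * a) := by
  -- The KMS condition speaks only of analytic `b`. Both sides are continuous in `b`, so homogeneous
  -- `b` suffice.
  have key : τ.comp (ContinuousLinearMap.mul ℂ _ a) =
      Complex.exp (-(d * β)) • τ.comp ((ContinuousLinearMap.mul ℂ _).flip a) := by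
    refine ContinuousLinearMap.ext_on dense_span_isHomogeneous ?_
    rintro b ⟨d', hb⟩
    have h := hτ.2 a b _ _ ha.isEntireOrbit hb.isEntireOrbit
    have h1 : (d : ℂ) * (Complex.I * β) * Complex.I = -(d * β) := by
      linear_combination (d : ℂ) * β * Complex.I_mul_I
    rw [mul_smul_comm, map_smul, h1] at h
    exact h
  exact congrArg (fun f => f b) key

end GraphCStar

/-! ### Fourier coefficients of periodic functions -/

/-- A continuous periodic function whose Fourier coefficients vanish is zero. -/
theorem Continuous.eq_zero_of_fourier_integral_eq_zero {k : ℝ → ℂ} (hk : Continuous k)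
    (hper : Function.Periodic k (2 * Real.pi))
    (h : ∀ n : ℤ, ∫ x in (0 : ℝ)..2 * Real.pi, Complex.exp (-(n * x * Complex.I)) * k x = 0)
    (x : ℝ) : k x = 0 := by
  have : Fact (0 < 2 * Real.pi) := ⟨Real.two_pi_pos⟩
  let f : C(AddCircle (2 * Real.pi), ℂ) := ⟨hper.lift, continuous_coinduced_dom.2 hk⟩
  have hf : ∀ n, fourierCoeff f n = 0 := by
    intro n
    rw [fourierCoeff_eq_intervalIntegral _ _ 0, zero_add]
    refine smul_eq_zero_of_right _ (Eq.trans (intervalIntegral.integral_congr fun x _ => ?_) (h n))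
    have h1 : (fourier (-n) (x : AddCircle (2 * Real.pi)) : ℂ) =
        Complex.exp (-(n * x * Complex.I)) := by
      rw [fourier_coe_apply]
      congr 1
      have : (Real.pi : ℂ) ≠ 0 := by exact_mod_cast Real.pi_ne_zero
      push_cast
      field_simp
    rw [← h1]
    rfl
  -- Vanishing coefficients are summable, so the Fourier series converges pointwise to the function,
  -- and its sum is zero.
  have hsum := has_pointwise_sum_fourier_series_of_summable (f := f)
    (by simp [funext hf]) (x : AddCircle (2 * Real.pi))
  simp only [hf, zero_smul] at hsum
  exact hsum.unique hasSum_zero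

/-- Shifting the line of integration of a periodic entire function. -/
theorem Differentiable.integral_add_mul_I_of_periodic {f : ℂ → ℂ} (hf : Differentiable ℂ f)
    {T : ℝ} (hper : ∀ z, f (z + T) = f z) (β : ℝ) :
    ∫ x in (0 : ℝ)..T, f (x + β * Complex.I) = ∫ x in (0 : ℝ)..T, f x := by
  have h := Complex.integral_boundary_rect_eq_zero_of_differentiableOn f 0 (T + β * Complex.I)
    hf.differentiableOn
  -- By periodicity the two vertical sides of the rectangle cancel in Cauchy's theorem.
  have h1 : ∀ y : ℝ, f (T + y * Complex.I) = f (y * Complex.I) := fun y => by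
    rw [add_comm, hper]
  simp [h1] at h
  exact (sub_eq_zero.1 h).symm

/-- An entire function with a period on the real line is periodic. -/
theorem Differentiable.periodic_of_real {f : ℂ → ℂ} (hf : Differentiable ℂ f)
    {T : ℝ} (hper : ∀ t : ℝ, f (t + T) = f t) (z : ℂ) : f (z + T) = f z := by
  have h1 : AnalyticOnNhd ℂ (fun z => f (z + T)) Set.univ := fun z _ =>
    Differentiable.analyticAt (by fun_prop) z
  have h2 : AnalyticOnNhd ℂ f Set.univ := fun z _ => hf.analyticAt z
  refine congrFun (h1.eq_of_frequently_eq h2 (z₀ := 0) ?_) z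
  -- Identity theorem: the two entire functions agree at real points accumulating at 0.
  have h3 : Filter.Tendsto (fun t : ℝ => (t : ℂ)) (nhdsWithin 0 {0}ᶜ) (nhdsWithin 0 {0}ᶜ) := by
    refine tendsto_nhdsWithin_iff.2 ⟨?_, ?_⟩
    · exact (Complex.continuous_ofReal.tendsto' 0 0 rfl).mono_left nhdsWithin_le_nhds
    · filter_upwards [self_mem_nhdsWithin] with t ht
      simpa using ht
  exact h3.frequently (Filter.Frequently.of_forall hper)

theorem integral_exp_int_mul_I_eq_zero {m : ℤ} (hm : m ≠ 0) :
    ∫ x in (0 : ℝ)..2 * Real.pi, Complex.exp (m * x * Complex.I) = 0 := by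
  have hc : (m * Complex.I : ℂ) ≠ 0 := mul_ne_zero (by exact_mod_cast hm) Complex.I_ne_zero
  have h := integral_exp_mul_complex (a := 0) (b := 2 * Real.pi) hc
  have h1 : Complex.exp (m * Complex.I * ((2 * Real.pi : ℝ) : ℂ)) = 1 := by
    rw [← Complex.exp_int_mul_two_pi_mul_I m]
    congr 1
    push_cast
    ring
  rw [h1] at h
  simp only [Complex.ofReal_zero, mul_zero, Complex.exp_zero, sub_self, zero_div] at h
  rw [← h]
  exact intervalIntegral.integral_congr fun x _ => by ring_nf

/-- A Fourier coefficient criterion for the values of a periodic entire function on a line parallel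
to the real axis. -/
theorem Differentiable.apply_mul_I_eq_of_fourier_integral_eq {f : ℂ → ℂ} {c : ℝ → ℂ} {β : ℝ}
    (hf : Differentiable ℂ f) (hc : Continuous c)
    (hfper : ∀ t : ℝ, f (t + (2 * Real.pi : ℝ)) = f t) (hcper : ∀ t, c (t + 2 * Real.pi) = c t)
    (h : ∀ n : ℤ, ∫ x in (0 : ℝ)..2 * Real.pi, Complex.exp (-(n * x * Complex.I)) * c x =
      Complex.exp (-(n * β)) *
        ∫ x in (0 : ℝ)..2 * Real.pi, Complex.exp (-(n * x * Complex.I)) * f x) :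
    f (β * Complex.I) = c 0 := by
  have hper := hf.periodic_of_real hfper
  have hfc : Continuous fun x : ℝ => f (x + β * Complex.I) :=
    hf.continuous.comp (by fun_prop)
  have key := Continuous.eq_zero_of_fourier_integral_eq_zero
    (k := fun x : ℝ => f (x + β * Complex.I) - c x) (hfc.sub hc) ?_ ?_ 0
  · simpa [sub_eq_zero] using key
  · intro x
    dsimp only
    rw [hcper, Complex.ofReal_add, add_right_comm, hper]
  · intro n
    -- Shifting the contour by iβ multiplies the kernel exp(-inx) by exp(nβ). The n-th Fourier
    -- integral of f(x + iβ) is therefore exp(-nβ) times that of f, which is also that of `c`.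
    have hshift := Differentiable.integral_add_mul_I_of_periodic
      (f := fun z => Complex.exp (-(n * z * Complex.I)) * f z) (T := 2 * Real.pi)
      (by fun_prop) (fun z => by
        rw [hper]
        congr 1
        rw [← mul_one (Complex.exp (-(n * z * Complex.I))),
          ← Complex.exp_int_mul_two_pi_mul_I (-n), ← Complex.exp_add]
        congr 1
        push_cast
        ring) β
    have h1 : ∫ x in (0 : ℝ)..2 * Real.pi,
        Complex.exp (-(n * x * Complex.I)) * f (x + β * Complex.I) =
          Complex.exp (-(n * β)) *
            ∫ x in (0 : ℝ)..2 * Real.pi, Complex.exp (-(n * x * Complex.I)) * f x := by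
      rw [← hshift, ← intervalIntegral.integral_const_mul]
      refine intervalIntegral.integral_congr fun x _ => ?_
      rw [← mul_assoc, ← Complex.exp_add]
      congr 2
      linear_combination (n : ℂ) * β * Complex.I_mul_I
    simp only [mul_sub]
    rw [intervalIntegral.integral_sub, h1, h, sub_self]
    · exact (Continuous.mul (by fun_prop) hfc).intervalIntegrable _ _
    · exact (Continuous.mul (by fun_prop) hc).intervalIntegrable _ _

/-! ### The KMS condition for analytic elements -/

namespace GraphCStar

variable {V : Type u} [Fintype V] {G : Digraph V}

theorem dynamics_add_two_pi (t : ℝ) : dynamics G (t + 2 * Real.pi) = dynamics G t := by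
  rw [dynamics, dynamics, Circle.exp_add, Circle.exp_two_pi, mul_one]

/-- Elements with which the functional `τ` commutes up to the factor prescribed by the KMS
condition. -/
def twistedCommutant (β : ℝ) (τ : GraphCStar G →L[ℂ] ℂ) : Set (GraphCStar G) :=
  {a | ∃ d, IsHomogeneous a d ∧ ∀ b, τ (a * b) = Complex.exp (-(d * β)) * τ (b * a)}

/-- Both sides are linear and continuous in `a`, so `a` may be taken in the twisted commutant, of
some degree d. Both integrals vanish for n ≠ d, and for n = d the claim is the twisted relation
itself. -/
theorem fourier_integral_dynamics {β : ℝ} {τ : GraphCStar G →L[ℂ] ℂ}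
    (hd : Dense (Submodule.span ℂ (twistedCommutant β τ) : Set (GraphCStar G)))
    (a b : GraphCStar G) (n : ℤ) :
    ∫ x in (0 : ℝ)..2 * Real.pi, Complex.exp (-(n * x * Complex.I)) * τ (dynamics G x a * b) =
      Complex.exp (-(n * β)) * ∫ x in (0 : ℝ)..2 * Real.pi,
        Complex.exp (-(n * x * Complex.I)) * τ (b * dynamics G x a) := by
  have hc1 : Continuous (Function.uncurry fun (a : GraphCStar G) (x : ℝ) =>
      Complex.exp (-(n * x * Complex.I)) * τ (dynamics G x a * b)) :=
    Continuous.mul (by fun_prop) (τ.continuous.comp (continuous_dynamics.mul continuous_const))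
  have hc2 : Continuous (Function.uncurry fun (a : GraphCStar G) (x : ℝ) =>
      Complex.exp (-(n * x * Complex.I)) * τ (b * dynamics G x a)) :=
    Continuous.mul (by fun_prop) (τ.continuous.comp (continuous_const.mul continuous_dynamics))
  have hi1 : ∀ a, IntervalIntegrable (fun x : ℝ =>
      Complex.exp (-(n * x * Complex.I)) * τ (dynamics G x a * b)) MeasureTheory.volume
      0 (2 * Real.pi) :=
    fun a => (hc1.comp (Continuous.prodMk_right a)).intervalIntegrable _ _
  have hi2 : ∀ a, IntervalIntegrable (fun x : ℝ =>
      Complex.exp (-(n * x * Complex.I)) * τ (b * dynamics G x a)) MeasureTheory.volume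
      0 (2 * Real.pi) :=
    fun a => (hc2.comp (Continuous.prodMk_right a)).intervalIntegrable _ _
  have hcl : IsClosed {a : GraphCStar G | ∫ x in (0 : ℝ)..2 * Real.pi,
      Complex.exp (-(n * x * Complex.I)) * τ (dynamics G x a * b) =
        Complex.exp (-(n * β)) * ∫ x in (0 : ℝ)..2 * Real.pi,
          Complex.exp (-(n * x * Complex.I)) * τ (b * dynamics G x a)} :=
    isClosed_eq
      (intervalIntegral.continuous_parametric_intervalIntegral_of_continuous' hc1 _ _)
      (continuous_const.mul
        (intervalIntegral.continuous_parametric_intervalIntegral_of_continuous' hc2 _ _))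
  refine hd.induction (fun a ha => ?_) hcl a
  induction ha using Submodule.span_induction with
  | mem a ha =>
    obtain ⟨d, ha, hab⟩ := ha
    have h1 : ∀ (x : ℝ) (c : ℂ), Complex.exp (-(n * x * Complex.I)) *
        (Complex.exp (d * x * Complex.I) * c) =
          Complex.exp ((d - n : ℤ) * x * Complex.I) * c := by
      intro x c
      rw [← mul_assoc, ← Complex.exp_add]
      push_cast
      ring_nf
    simp only [ha _, smul_mul_assoc, mul_smul_comm, map_smul, smul_eq_mul, h1,
      intervalIntegral.integral_mul_const]
    by_cases hdn : d = n
    · rw [hab, hdn]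
      ring
    · rw [integral_exp_int_mul_I_eq_zero (sub_ne_zero.2 hdn)]
      ring
  | zero => simp
  | add a a' _ _ ha ha' =>
    simp only [map_add, add_mul, mul_add]
    rw [intervalIntegral.integral_add (hi1 a) (hi1 a'),
      intervalIntegral.integral_add (hi2 a) (hi2 a'), ha, ha', mul_add]
  | smul c a _ ha =>
    simp only [map_smul, smul_mul_assoc, mul_smul_comm]
    rw [intervalIntegral.integral_smul, intervalIntegral.integral_smul, ha, mul_smul_comm]

theorem dynamics_zero (a : GraphCStar G) : dynamics G 0 a = a := by
  have : dynamics G 0 = StarAlgHom.id ℂ (GraphCStar G) :=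
    hom_ext (fun v => dynamics_p 0 v) (fun e => by simp [dynamics_S])
  rw [this]
  rfl

/-- It suffices to verify the KMS condition on a total set of homogeneous elements. -/
theorem isKMSState_of_dense {β : ℝ} {τ : GraphCStar G →L[ℂ] ℂ} (hτ : IsState τ)
    (hd : Dense (Submodule.span ℂ (twistedCommutant β τ) : Set (GraphCStar G))) :
    IsKMSState (dynamics G) β τ := by
  refine ⟨hτ, fun a b F _ hF _ => ?_⟩
  have hf : Differentiable ℂ fun z => τ (b * F z) :=
    (τ.comp (ContinuousLinearMap.mul ℂ _ b)).differentiable.comp hF.1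
  have hc : Continuous fun x : ℝ => τ (dynamics G x a * b) :=
    τ.continuous.comp ((continuous_dynamics.comp (Continuous.prodMk_right a)).mul continuous_const)
  -- Applied to f(z) = τ(b F(z)) and c(t) = τ(σ_t(a) b), whose value at 0 is τ(ab).
  have key := hf.apply_mul_I_eq_of_fourier_integral_eq (β := β) hc (fun t => ?_) (fun t => ?_)
    (fun n => ?_)
  · rw [mul_comm Complex.I, key, dynamics_zero]
  · rw [← Complex.ofReal_add, hF.2, hF.2, dynamics_add_two_pi]
  · rw [dynamics_add_two_pi]
  · simp only [hF.2]
    exact fourier_integral_dynamics hd a b n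

end GraphCStar

/-! ### Isometries of `ℓ²` spaces given by injections -/

section EllTwo

open scoped lp InnerProduct

/-- The standard Hilbert basis of `ℓ²(ι, ℂ)`. -/
noncomputable def l2Basis (ι : Type u) : HilbertBasis ι ℂ ℓ²(ι, ℂ) :=
  HilbertBasis.ofRepr (LinearIsometryEquiv.refl ℂ _)

variable {ι κ : Type u}

/-- The isometry which maps basis vectors to basis vectors along an injection. -/
noncomputable def l2Map (f : ι → κ) (hf : Function.Injective f) :
    ℓ²(ι, ℂ) →ₗᵢ[ℂ] ℓ²(κ, ℂ) :=
  ((l2Basis κ).orthonormal.comp f hf).orthogonalFamily.linearIsometry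

theorem l2Map_basis (f : ι → κ) (hf : Function.Injective f) (i : ι) :
    l2Map f hf (l2Basis ι i) = l2Basis κ (f i) := by
  classical
  have h : l2Basis ι i = lp.single 2 i (1 : ℂ) := by
    rw [← HilbertBasis.repr_symm_single]
    rfl
  rw [h, l2Map, OrthogonalFamily.linearIsometry_apply_single]
  simp

theorem l2_ext {E : Type v} [NormedAddCommGroup E] [NormedSpace ℂ E] {A B : ℓ²(ι, ℂ) →L[ℂ] E}
    (h : ∀ i, A (l2Basis ι i) = B (l2Basis ι i)) : A = B := by
  refine ContinuousLinearMap.ext_on (s := Set.range (l2Basis ι)) ?_ ?_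
  · rw [dense_iff_closure_eq, ← Submodule.topologicalClosure_coe, HilbertBasis.dense_span]
    rfl
  · rintro _ ⟨i, rfl⟩
    exact h i

/-- `l2Map` as a continuous linear map. -/
noncomputable def l2MapL (f : ι → κ) (hf : Function.Injective f) : ℓ²(ι, ℂ) →L[ℂ] ℓ²(κ, ℂ) :=
  (l2Map f hf).toContinuousLinearMap

theorem l2MapL_basis (f : ι → κ) (hf : Function.Injective f) (i : ι) :
    l2MapL f hf (l2Basis ι i) = l2Basis κ (f i) := l2Map_basis f hf i

theorem adjoint_l2MapL_comp (f : ι → κ) (hf : Function.Injective f) :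
    (l2MapL f hf)† ∘L l2MapL f hf = ContinuousLinearMap.id ℂ _ :=
  (ContinuousLinearMap.norm_map_iff_adjoint_comp_self _).1 (l2Map f hf).norm_map

theorem adjoint_l2MapL_basis (f : ι → κ) (hf : Function.Injective f) (i : ι) :
    ((l2MapL f hf)†) (l2Basis κ (f i)) = l2Basis ι i := by
  rw [← l2MapL_basis f hf]
  exact congrArg (fun A => A (l2Basis ι i)) (adjoint_l2MapL_comp f hf)

theorem adjoint_l2MapL_basis_of_notMem (f : ι → κ) (hf : Function.Injective f) {k : κ}
    (hk : ∀ i, f i ≠ k) : ((l2MapL f hf)†) (l2Basis κ k) = 0 := by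
  -- The vector is orthogonal to every basis vector, hence to itself.
  have h : innerSL ℂ (((l2MapL f hf)†) (l2Basis κ k)) = 0 := by
    refine l2_ext fun i => ?_
    rw [innerSL_apply_apply, ContinuousLinearMap.adjoint_inner_left, l2MapL_basis]
    exact (l2Basis κ).orthonormal.2 (hk i).symm
  have h2 := congrArg (fun A => A (((l2MapL f hf)†) (l2Basis κ k))) h
  simpa using h2

end EllTwo

/-! ### A representation of the graph algebra -/

section Representation

open scoped lp InnerProduct

variable {V : Type u} [Fintype V] {G : Digraph V}

/-- The edges emitted by `v`, each counted infinitely often, can be enumerated. -/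
theorem Digraph.exists_equiv_nat (hG : ∀ v, ∃ e : G.Edge, e.src = v) (v : V) :
    Nonempty (ℕ ≃ {e : G.Edge // e.src = v} × ℕ) := by
  have : Nonempty {e : G.Edge // e.src = v} := let ⟨e, he⟩ := hG v; ⟨e, he⟩
  have : Countable {e : G.Edge // e.src = v} := inferInstance
  exact nonempty_equiv_of_countable

/-- A graph without sinks has a Cuntz–Krieger family on a Hilbert space whose vertex projections
have fixed unit vectors. -/
theorem CKFamily.exists_on_hilbert (hG : ∀ v, ∃ e : G.Edge, e.src = v) :
    ∃ (f : CKFamily G (ℓ²(V × ℕ, ℂ) →L[ℂ] ℓ²(V × ℕ, ℂ))) (ξ : V → ℓ²(V × ℕ, ℂ)),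
      (∀ v, ‖ξ v‖ = 1) ∧ (∀ v, f.p v (ξ v) = ξ v) ∧ ∀ v w, v ≠ w → f.p v (ξ w) = 0 := by
  classical
  -- `θ v` distributes the basis vectors (v, n) among the edges leaving `v`, infinitely many to
  -- each. `J v` is an isometry onto the vectors at `v`, and `T e` one onto those labelled `e`, so
  -- that T_e J_{t(e)}† maps the space at the target of `e` onto its share at the source. `ULift`
  -- only adjusts the universe of the index set.
  have θ : ∀ v : V, ℕ ≃ {e : G.Edge // e.src = v} × ℕ := fun v =>
    (Digraph.exists_equiv_nat hG v).some
  have hJ : ∀ v : V, Function.Injective fun n : ULift.{u} ℕ => (v, n.down) := fun v n m h =>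
    ULift.ext _ _ (Prod.ext_iff.1 h).2
  have hT : ∀ e : G.Edge, Function.Injective fun n : ULift.{u} ℕ =>
      (e.src, (θ e.src).symm (⟨e, rfl⟩, n.down)) := fun e n m h => by
    have := (θ e.src).symm.injective (Prod.ext_iff.1 h).2
    exact ULift.ext _ _ (Prod.ext_iff.1 this).2
  let J : V → ℓ²(ULift.{u} ℕ, ℂ) →L[ℂ] ℓ²(V × ℕ, ℂ) := fun v => l2MapL _ (hJ v)
  let T : G.Edge → ℓ²(ULift.{u} ℕ, ℂ) →L[ℂ] ℓ²(V × ℕ, ℂ) := fun e => l2MapL _ (hT e)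
  have hJJ : ∀ v, (J v)† ∘L J v = ContinuousLinearMap.id ℂ _ := fun v => adjoint_l2MapL_comp _ _
  have hTT : ∀ e, (T e)† ∘L T e = ContinuousLinearMap.id ℂ _ := fun e => adjoint_l2MapL_comp _ _
  have hpb : ∀ v n, (J v ∘L (J v)†) (l2Basis _ (v, n)) = l2Basis _ (v, n) := fun v n => by
    have h1 : ((J v)†) (l2Basis _ (v, n)) = l2Basis _ (ULift.up n) :=
      adjoint_l2MapL_basis _ (hJ v) (ULift.up n)
    have h2 : J v (l2Basis _ (ULift.up n)) = l2Basis _ (v, n) :=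
      l2MapL_basis _ (hJ v) (ULift.up n)
    rw [ContinuousLinearMap.comp_apply, h1, h2]
  have hpb' : ∀ v w n, v ≠ w → (J v ∘L (J v)†) (l2Basis _ (w, n)) = 0 := fun v w n h => by
    have h1 : ((J v)†) (l2Basis _ (w, n)) = 0 :=
      adjoint_l2MapL_basis_of_notMem _ (hJ v) fun i hi => h (Prod.ext_iff.1 hi).1
    rw [ContinuousLinearMap.comp_apply, h1, map_zero]
  have hTb : ∀ (e : G.Edge) v n, v = e.src → (T e ∘L (T e)†) (l2Basis _ (v, n)) =
      if (θ v n).1.1 = e then l2Basis _ (v, n) else 0 := by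
    rintro e _ n rfl
    split_ifs with h
    · have hn : n = (θ e.src).symm (⟨e, rfl⟩, (θ e.src n).2) := by
        rw [Equiv.eq_symm_apply]
        exact Prod.ext (Subtype.ext h) rfl
      have h1 : ((T e)†) (l2Basis _ (e.src, n)) = l2Basis _ (ULift.up (θ e.src n).2) := by
        conv_lhs => rw [hn]
        exact adjoint_l2MapL_basis _ (hT e) (ULift.up (θ e.src n).2)
      have h2 : T e (l2Basis _ (ULift.up (θ e.src n).2)) = l2Basis _ (e.src, n) := by
        conv_rhs => rw [hn]
        exact l2MapL_basis _ (hT e) (ULift.up (θ e.src n).2)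
      rw [ContinuousLinearMap.comp_apply, h1, h2]
    · have h1 : ((T e)†) (l2Basis _ (e.src, n)) = 0 := by
        refine adjoint_l2MapL_basis_of_notMem _ (hT e) fun i hi => h ?_
        have h2 : (θ e.src).symm (⟨e, rfl⟩, i.down) = n := (Prod.ext_iff.1 hi).2
        rw [← h2, Equiv.apply_symm_apply]
      rw [ContinuousLinearMap.comp_apply, h1, map_zero]
  have hTb' : ∀ (e : G.Edge) v n, e.src ≠ v → (T e ∘L (T e)†) (l2Basis _ (v, n)) = 0 :=
    fun e v n h => by
      have h1 : ((T e)†) (l2Basis _ (v, n)) = 0 :=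
        adjoint_l2MapL_basis_of_notMem _ (hT e) fun i hi => h (Prod.ext_iff.1 hi).1
      rw [ContinuousLinearMap.comp_apply, h1, map_zero]
  refine ⟨{ p := fun v => J v ∘L (J v)†
            S := fun e => T e ∘L (J e.tgt)†
            p_proj := fun v => ⟨?_, ?_⟩
            p_orth := fun v w h => ?_
            star_mul_self := fun e => ?_
            sum_edges := fun v _ => ?_
            sum_one := ?_ }, fun v => l2Basis _ (v, 0), fun v => (l2Basis _).orthonormal.1 _,
            fun v => hpb v 0, fun v w h => hpb' v w 0 h⟩
  · change (J v ∘L (J v)†) ∘L (J v ∘L (J v)†) = _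
    rw [ContinuousLinearMap.comp_assoc, ← ContinuousLinearMap.comp_assoc ((J v)†), hJJ,
      ContinuousLinearMap.id_comp]
  · rw [isSelfAdjoint_iff, ContinuousLinearMap.star_eq_adjoint, ContinuousLinearMap.adjoint_comp,
      ContinuousLinearMap.adjoint_adjoint]
  · refine l2_ext fun ⟨x, n⟩ => ?_
    rw [mul_apply_eq_comp]
    by_cases hx : w = x
    · subst hx
      rw [hpb, hpb' _ _ _ h]
      rfl
    · rw [hpb' _ _ _ hx, map_zero]
      rfl
  · rw [ContinuousLinearMap.star_eq_adjoint, ContinuousLinearMap.adjoint_comp,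
      ContinuousLinearMap.adjoint_adjoint]
    change (J e.tgt ∘L (T e)†) ∘L (T e ∘L (J e.tgt)†) = _
    rw [ContinuousLinearMap.comp_assoc, ← ContinuousLinearMap.comp_assoc ((T e)†), hTT,
      ContinuousLinearMap.id_comp]
  · have h1 : ∀ e : G.Edge, (T e ∘L (J e.tgt)†) * star (T e ∘L (J e.tgt)†) = T e ∘L (T e)† := by
      intro e
      rw [ContinuousLinearMap.star_eq_adjoint, ContinuousLinearMap.adjoint_comp,
        ContinuousLinearMap.adjoint_adjoint]
      change (T e ∘L (J e.tgt)†) ∘L (J e.tgt ∘L (T e)†) = _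
      rw [ContinuousLinearMap.comp_assoc, ← ContinuousLinearMap.comp_assoc ((J e.tgt)†), hJJ,
        ContinuousLinearMap.id_comp]
    simp only [h1]
    refine l2_ext fun ⟨w, n⟩ => ?_
    rw [sum_apply]
    by_cases hw : v = w
    · subst hw
      -- Each basis vector at `v` carries exactly one label, so a single range projection fixes it
      -- and the others annihilate it.
      rw [hpb, Finset.sum_eq_single_of_mem (θ v n).1.1 (by simpa using (θ v n).1.2)]
      · rw [hTb _ _ _ (θ v n).1.2.symm, if_pos rfl]
      · intro e he hne
        rw [hTb _ _ _ (by simpa using (Finset.mem_filter.1 he).2.symm), if_neg hne.symm]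
    · rw [hpb' _ _ _ hw]
      refine Finset.sum_eq_zero fun e he => hTb' _ _ _ ?_
      rwa [(Finset.mem_filter.1 he).2]
  · refine l2_ext fun ⟨w, n⟩ => ?_
    rw [sum_apply, Finset.sum_eq_single_of_mem w (Finset.mem_univ w)]
    · rw [hpb]
      rfl
    · exact fun v _ h => hpb' _ _ _ h

end Representation

/-! ### Bounds for states -/

/-- Positive functionals taking the value one at the unit are uniformly bounded. -/
theorem IsState.norm_apply_le {A : Type u} [CStarAlgebra A] {τ : A →L[ℂ] ℂ} (hτ : IsState τ)
    (a : A) : ‖τ a‖ ≤ 4 * ‖a‖ := by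
  let _ : PartialOrder A := CStarAlgebra.spectralOrder A
  have _ : StarOrderedRing A := CStarAlgebra.spectralOrderedRing A
  have hmono : Monotone τ.toLinearMap := by
    intro a b hab
    rw [← sub_nonneg] at hab
    obtain ⟨c, hc⟩ := CStarAlgebra.nonneg_iff_eq_star_mul_self.1 hab
    have := hτ.1 c
    rw [← hc, map_sub, sub_nonneg] at this
    exact this
  let f : A →ₚ[ℂ] ℂ := { τ.toLinearMap with monotone' := hmono }
  have hf : ∀ a, f a = τ a := fun a => rfl
  -- The element is a combination, with coefficients of modulus one, of four positive elements of
  -- norm at most ‖a‖; hence the constant 4. Only its uniformity matters, for weak-⋆ compactness.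
  obtain ⟨x, hx, hxa, hsum⟩ := CStarAlgebra.exists_sum_four_nonneg a
  have h1 : ∀ i, ‖τ (x i)‖ ≤ ‖a‖ := fun i => by
    have := f.norm_apply_le_of_nonneg (x i) (hx i)
    rw [hf, hf, hτ.2, norm_one, one_mul] at this
    exact this.trans (hxa i)
  conv_lhs => rw [hsum, map_sum]
  refine (norm_sum_le _ _).trans ((Finset.sum_le_sum (g := fun _ => ‖a‖) fun i _ => ?_).trans ?_)
  · rw [map_smul, norm_smul]
    simpa using h1 i
  · simp

namespace GraphCStar

variable {V : Type u} [Fintype V] {G : Digraph V}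

/-! ### The transfer operator -/

/-- The operator `φ ↦ λ⁻¹ ∑ₑ φ(Sₑ⋆ · Sₑ)` on functionals. -/
noncomputable def transfer (lam : ℝ) (φ : GraphCStar G →L[ℂ] ℂ) : GraphCStar G →L[ℂ] ℂ :=
  (lam : ℂ)⁻¹ • ∑ e : G.Edge, φ.comp
    (ContinuousLinearMap.mulLeftRight ℂ (GraphCStar G) (star ((family G).S e)) ((family G).S e))

theorem transfer_apply (lam : ℝ) (φ : GraphCStar G →L[ℂ] ℂ) (a : GraphCStar G) :
    transfer lam φ a =
      (lam : ℂ)⁻¹ * ∑ e : G.Edge, φ (star ((family G).S e) * a * (family G).S e) := by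
  simp [transfer, sum_apply]

theorem sum_edge_eq {M : Type v} [AddCommMonoid M] (v : V) (f : V → M) :
    open scoped Classical in
    ∑ e : G.Edge with e.src = v, f e.tgt = ∑ w, if G.Adj v w then f w else 0 := by
  classical
  rw [← Finset.sum_filter]
  refine Finset.sum_bij' (fun e _ => e.tgt) (fun w hw => ⟨v, w, (Finset.mem_filter.1 hw).2⟩)
    ?_ ?_ ?_ ?_ ?_
  · intro e he
    have := e.adj
    rw [(Finset.mem_filter.1 he).2] at this
    simpa using this
  · intro w hw
    simp
  · intro e he
    exact Digraph.Edge.eq_of (Finset.mem_filter.1 he).2.symm rfl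
  · intro w hw
    rfl
  · intro e he
    rfl

/-- States with prescribed values at the vertex projections. -/
structure IsStateWith (x : V → ℝ) (φ : GraphCStar G →L[ℂ] ℂ) : Prop where
  isState : IsState φ
  apply_p : ∀ v, φ ((family G).p v) = x v

theorem isStateWith_of {x : V → ℝ} (hsum : ∑ v, x v = 1) {φ : GraphCStar G →L[ℂ] ℂ}
    (hpos : ∀ a, 0 ≤ φ (star a * a)) (hp : ∀ v, φ ((family G).p v) = x v) : IsStateWith x φ := by
  refine ⟨⟨hpos, ?_⟩, hp⟩
  rw [← (family G).sum_one, map_sum]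
  simp only [hp]
  exact_mod_cast hsum

/-- S_e⋆ p_v S_e is p_{t(e)} if `e` leaves `v` and 0 otherwise. The new value at p_v is thus λ⁻¹
times the sum of x over the neighbours of v, which is x_v. -/
theorem IsStateWith.transfer {x : V → ℝ} {lam : ℝ} (hlam : 0 < lam) (hsum : ∑ v, x v = 1)
    (hx : G.IsEigenvector lam x) {φ : GraphCStar G →L[ℂ] ℂ} (hφ : IsStateWith x φ) :
    IsStateWith x (transfer lam φ) := by
  classical
  refine isStateWith_of hsum (fun a => ?_) fun v => ?_
  · rw [transfer_apply]
    refine mul_nonneg ?_ (Finset.sum_nonneg fun e _ => ?_)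
    · rw [← Complex.ofReal_inv]
      exact_mod_cast (inv_pos.2 hlam).le
    · have := hφ.isState.1 (a * (family G).S e)
      rwa [star_mul, mul_assoc, ← mul_assoc (star a), ← mul_assoc] at this
  · rw [transfer_apply, ← Finset.sum_subset (Finset.subset_univ
      (Finset.univ.filter fun e : G.Edge => e.src = v))]
    · have h1 : ∀ e ∈ Finset.univ.filter fun e : G.Edge => e.src = v,
          φ (star ((family G).S e) * (family G).p v * (family G).S e) = x e.tgt := by
        intro e he
        rw [← (Finset.mem_filter.1 he).2, CKFamily.star_S_mul_p, CKFamily.star_mul_self,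
          hφ.apply_p]
      rw [Finset.sum_congr rfl h1, sum_edge_eq v fun w => (x w : ℂ)]
      have h2 : ∑ w, (if G.Adj v w then (x w : ℂ) else 0) = lam * x v := by
        rw [← Complex.ofReal_mul, ← hx v, Complex.ofReal_sum]
        exact Finset.sum_congr rfl fun w _ => by split_ifs <;> simp
      rw [h2, inv_mul_cancel_left₀ (by exact_mod_cast hlam.ne')]
    · intro e _ he
      rw [CKFamily.star_S_mul_p_of_ne _ (by simpa using he), zero_mul, map_zero]

/-- Functionals fixed by the transfer operator satisfy the KMS condition. -/
theorem isKMSState_of_transfer_eq {lam : ℝ} (hlam : 0 < lam) {τ : GraphCStar G →L[ℂ] ℂ}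
    (hτ : IsState τ) (h : transfer lam τ = τ) : IsKMSState (dynamics G) (Real.log lam) τ := by
  classical
  have hlam0 : (lam : ℂ) ≠ 0 := by exact_mod_cast hlam.ne'
  have ht : ∀ a, τ a = (lam : ℂ)⁻¹ * ∑ e : G.Edge,
      τ (star ((family G).S e) * a * (family G).S e) := fun a => by
    rw [← transfer_apply, h]
  have hexp : Complex.exp (Real.log lam) = lam := by
    rw [← Complex.ofReal_exp, Real.exp_log hlam]
  -- Both sides are expanded by the fixed point equation; only edges leaving `v` survive, and on
  -- these p_v is absorbed.
  have hp : ∀ v b, τ ((family G).p v * b) = τ (b * (family G).p v) := by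
    intro v b
    rw [ht, ht (b * _)]
    congr 1
    refine Finset.sum_congr rfl fun e _ => ?_
    by_cases he : e.src = v
    · subst he
      rw [← mul_assoc, CKFamily.star_S_mul_p, mul_assoc, mul_assoc, mul_assoc, CKFamily.p_mul_S]
    · rw [← mul_assoc, CKFamily.star_S_mul_p_of_ne _ he, mul_assoc, mul_assoc, mul_assoc b,
        CKFamily.p_mul_S_of_ne _ he]
      simp
  -- In the expansion of τ(S_e b) the orthogonality of ranges leaves only the term of `e`, which is
  -- λ⁻¹ τ(p_{t(e)} b S_e).
  have hS : ∀ e b, τ ((family G).S e * b) = (lam : ℂ)⁻¹ * τ (b * (family G).S e) := by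
    intro e b
    rw [ht, Finset.sum_eq_single_of_mem e (Finset.mem_univ e)]
    · rw [← mul_assoc, CKFamily.star_mul_self, mul_assoc, hp, mul_assoc, CKFamily.S_mul_p]
    · intro e' _ he
      rw [← mul_assoc, CKFamily.star_S_mul_S_of_ne _ he, zero_mul, zero_mul, map_zero]
  have hS' : ∀ e b, τ (star ((family G).S e) * b) = lam * τ (b * star ((family G).S e)) := by
    intro e b
    rw [ht (b * _), mul_inv_cancel_left₀ hlam0,
      Finset.sum_eq_single_of_mem e (Finset.mem_univ e)]
    · rw [mul_assoc, mul_assoc, CKFamily.star_mul_self, ← mul_assoc, ← hp, ← mul_assoc,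
        CKFamily.p_mul_star_S]
    · intro e' _ he
      rw [mul_assoc, mul_assoc, CKFamily.star_S_mul_S_of_ne _ he.symm, mul_zero, mul_zero,
        map_zero]
  -- Both the degrees and the factors exp(-dβ) are compatible with products, so the relations for
  -- generators propagate to all words.
  have hmul : ∀ {a a' : GraphCStar G}, a ∈ twistedCommutant (Real.log lam) τ →
      a' ∈ twistedCommutant (Real.log lam) τ →
        a * a' ∈ Submodule.span ℂ (twistedCommutant (Real.log lam) τ) := by
    rintro a a' ⟨d, ha, hab⟩ ⟨d', ha', hab'⟩
    refine Submodule.subset_span ⟨d + d', ha.mul ha', fun b => ?_⟩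
    rw [mul_assoc, hab, mul_assoc, hab', mul_assoc, ← mul_assoc, ← Complex.exp_add]
    push_cast
    ring_nf
  refine isKMSState_of_dense hτ (dense_span_of_mul_mem ?_ ?_ ?_ ?_)
  · exact Submodule.subset_span ⟨0, .one, fun b => by simp⟩
  · exact fun v a ha => hmul ⟨0, isHomogeneous_p v, fun b => by simpa using hp v b⟩ ha
  · exact fun e a ha => hmul ⟨1, isHomogeneous_S e, fun b => by
      simpa [Complex.exp_neg, hexp] using hS e b⟩ ha
  · exact fun e a ha => hmul ⟨-1, (isHomogeneous_S e).star, fun b => by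
      simpa [hexp] using hS' e b⟩ ha

/-! ### Existence of KMS states -/

open scoped lp in
/-- A graph without sinks has states with arbitrary values at the vertex projections. -/
theorem exists_isStateWith (hG : ∀ v, ∃ e : G.Edge, e.src = v) {x : V → ℝ} (hx : ∀ v, 0 ≤ x v)
    (hsum : ∑ v, x v = 1) : ∃ φ : GraphCStar G →L[ℂ] ℂ, IsStateWith x φ := by
  classical
  obtain ⟨f, ξ, hξ, hp, hp'⟩ := CKFamily.exists_on_hilbert hG
  let π : GraphCStar G →L[ℂ] (ℓ²(V × ℕ, ℂ) →L[ℂ] ℓ²(V × ℕ, ℂ)) :=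
    ⟨(lift f).toAlgHom.toLinearMap, continuous_liftFun f⟩
  have hπ : ∀ a, π a = lift f a := fun a => rfl
  -- The convex combination, with weights x_v, of the vector states of the ξ_v.
  let φ : GraphCStar G →L[ℂ] ℂ := ∑ v, (x v : ℂ) •
    ((innerSL ℂ (ξ v)).comp ((ContinuousLinearMap.apply ℂ _ (ξ v)).comp π))
  have hφ : ∀ a, φ a = ∑ v, (x v : ℂ) * inner ℂ (ξ v) (lift f a (ξ v)) := fun a => by
    simp [φ, sum_apply, hπ]
  refine ⟨φ, isStateWith_of hsum (fun a => ?_) fun w => ?_⟩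
  · rw [hφ]
    refine Finset.sum_nonneg fun v _ => mul_nonneg (by exact_mod_cast hx v) ?_
    rw [map_mul, map_star, ContinuousLinearMap.star_eq_adjoint, mul_apply_eq_comp,
      ContinuousLinearMap.adjoint_inner_right, inner_self_eq_norm_sq_to_K]
    exact pow_nonneg (Complex.zero_le_real.2 (norm_nonneg (lift f a (ξ v)))) 2
  · rw [hφ, Finset.sum_eq_single_of_mem w (Finset.mem_univ w)]
    · rw [lift_p, hp, inner_self_eq_norm_sq_to_K, hξ]
      simp
    · intro v _ hv
      rw [lift_p, hp' _ _ hv.symm, inner_zero_right, mul_zero]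

/-- The transfer operator has fixed points in the states with vertex values given by an
eigenvector. -/
theorem exists_transfer_eq {x : V → ℝ} {lam : ℝ} (hlam : 0 < lam) (hsum : ∑ v, x v = 1)
    (hx : G.IsEigenvector lam x) {φ : GraphCStar G →L[ℂ] ℂ} (hφ : IsStateWith x φ) :
    ∃ τ : GraphCStar G →L[ℂ] ℂ, IsStateWith x τ ∧ transfer lam τ = τ := by
  let ψ : ℕ → GraphCStar G →L[ℂ] ℂ := fun n => (transfer lam)^[n] φ
  have hψ : ∀ n, IsStateWith x (ψ n) := by
    intro n
    induction n with
    | zero => exact hφ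
    | succ n ih =>
      simp only [ψ, Function.iterate_succ_apply']
      exact ih.transfer hlam hsum hx
  -- Cesàro means of the orbit, as in the Markov–Kakutani theorem; applying the transfer operator
  -- changes `m N` only by a telescoped term of order 1/(N + 1).
  let m : ℕ → GraphCStar G →L[ℂ] ℂ := fun N => ((N + 1 : ℕ) : ℂ)⁻¹ • ∑ n ∈ Finset.range (N + 1), ψ n
  have hm_apply : ∀ N a, m N a = ((N + 1 : ℕ) : ℂ)⁻¹ * ∑ n ∈ Finset.range (N + 1), ψ n a :=
    fun N a => by simp [m, sum_apply]
  have hN : ∀ N : ℕ, ((N + 1 : ℕ) : ℂ) ≠ 0 := fun N => Nat.cast_ne_zero.2 N.succ_ne_zero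
  have hm : ∀ N, IsStateWith x (m N) := by
    intro N
    refine isStateWith_of hsum (fun a => ?_) fun v => ?_
    · rw [hm_apply]
      refine mul_nonneg ?_ (Finset.sum_nonneg fun n _ => (hψ n).isState.1 a)
      have : (0 : ℝ) ≤ ((N + 1 : ℕ) : ℝ)⁻¹ := by positivity
      have h2 := Complex.zero_le_real.2 this
      simpa using h2
    · rw [hm_apply, Finset.sum_congr rfl fun n _ => (hψ n).apply_p v, Finset.sum_const,
        Finset.card_range, nsmul_eq_mul, inv_mul_cancel_left₀ (hN N)]
  have hmt : ∀ N a, transfer lam (m N) a - m N a =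
      ((N + 1 : ℕ) : ℂ)⁻¹ * (ψ (N + 1) a - ψ 0 a) := by
    intro N a
    have h1 : transfer lam (m N) a =
        ((N + 1 : ℕ) : ℂ)⁻¹ * ∑ n ∈ Finset.range (N + 1), ψ (n + 1) a := by
      have h2 : ∀ n, ψ (n + 1) a = (lam : ℂ)⁻¹ *
          ∑ e : G.Edge, ψ n (star ((family G).S e) * a * (family G).S e) := fun n => by
        rw [← transfer_apply]
        simp only [ψ, Function.iterate_succ_apply']
      simp only [transfer_apply, hm_apply, h2]
      rw [← Finset.mul_sum, ← Finset.mul_sum, Finset.sum_comm]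
      ring
    rw [h1, hm_apply, ← mul_sub, ← Finset.sum_sub_distrib, Finset.sum_range_sub (fun n => ψ n a)]
  -- All `m N` lie in the weak-⋆ compact ball of radius 4, so they converge along a free
  -- ultrafilter.
  obtain ⟨τ, -, hτ⟩ := (WeakDual.isCompact_closedBall (𝕜 := ℂ) (E := GraphCStar G) 0
    4).ultrafilter_le_nhds ((Filter.hyperfilter ℕ).map fun N => StrongDual.toWeakDual (m N)) (by
      rw [Ultrafilter.coe_map, Filter.le_principal_iff, Filter.mem_map]
      refine Filter.univ_mem' fun N => ?_
      rw [Set.mem_preimage, Set.mem_preimage, mem_closedBall_zero_iff]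
      exact ContinuousLinearMap.opNorm_le_bound _ (by norm_num) (hm N).isState.norm_apply_le)
  have hlim : ∀ a, Filter.Tendsto (fun N => m N a) (Filter.hyperfilter ℕ) (nhds (τ a)) :=
    fun a => ((WeakDual.eval_continuous a).tendsto τ).comp hτ
  let τ' : GraphCStar G →L[ℂ] ℂ := WeakDual.toStrongDual τ
  change ∀ a, Filter.Tendsto (fun N => m N a) (Filter.hyperfilter ℕ) (nhds (τ' a)) at hlim
  refine ⟨τ', isStateWith_of hsum (fun a => ?_) fun v => ?_, ?_⟩
  · exact ge_of_tendsto' (hlim _) fun N => (hm N).isState.1 a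
  · refine tendsto_nhds_unique (hlim _) ?_
    simp only [(hm _).apply_p]
    exact tendsto_const_nhds
  · ext a
    have h1 : Filter.Tendsto (fun N => transfer lam (m N) a - m N a) (Filter.hyperfilter ℕ)
        (nhds (transfer lam τ' a - τ' a)) := by
      refine Filter.Tendsto.sub ?_ (hlim a)
      simp only [transfer_apply]
      exact (tendsto_finsetSum _ fun e _ => hlim _).const_mul _
    have h2 : Filter.Tendsto (fun N => transfer lam (m N) a - m N a) (Filter.hyperfilter ℕ)
        (nhds 0) := by
      refine Filter.Tendsto.mono_left ?_ (Nat.hyperfilter_le_atTop)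
      -- The 8 is 4 + 4, from the bounds on the two end terms of the telescoping sum.
      refine squeeze_zero_norm (a := fun N : ℕ => (8 * ‖a‖) * (1 / ((N : ℝ) + 1))) (fun N => ?_) ?_
      · rw [hmt, norm_mul, norm_inv, Complex.norm_natCast, Nat.cast_add, Nat.cast_one, mul_comm,
          one_div]
        refine mul_le_mul_of_nonneg_right ?_ (by positivity)
        have h3 := (hψ (N + 1)).isState.norm_apply_le a
        have h4 := (hψ 0).isState.norm_apply_le a
        linarith [norm_sub_le (ψ (N + 1) a) (ψ 0 a)]
      · simpa using (tendsto_one_div_add_atTop_nhds_zero_nat (𝕜 := ℝ)).const_mul (8 * ‖a‖)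
    exact sub_eq_zero.1 (tendsto_nhds_unique h1 h2)

/-- Nonnegative normalized eigenvectors of the vertex matrix give KMS states. -/
theorem exists_isKMSState {x : V → ℝ} {lam : ℝ} (hlam : 0 < lam)
    (hG : ∀ v, ∃ e : G.Edge, e.src = v) (hx0 : ∀ v, 0 ≤ x v) (hsum : ∑ v, x v = 1)
    (hx : G.IsEigenvector lam x) :
    ∃ τ : GraphCStar G →L[ℂ] ℂ, IsKMSState (dynamics G) (Real.log lam) τ ∧
      ∀ v, τ ((family G).p v) = x v := by
  obtain ⟨φ, hφ⟩ := exists_isStateWith hG hx0 hsum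
  obtain ⟨τ, hτ, h⟩ := exists_transfer_eq hlam hsum hx hφ
  exact ⟨τ, isKMSState_of_transfer_eq hlam hτ.isState h, hτ.apply_p⟩

end GraphCStar

namespace CKFamily

variable {V : Type u} [Fintype V] {G : Digraph V} {A : Type v} [CStarAlgebra A]

/-! ### Products along lists of edges -/

/-- The product of the `S e` along a list of edges. -/
def prodS (f : CKFamily G A) (μ : List G.Edge) : A := (μ.map f.S).prod

@[simp]
theorem prodS_nil (f : CKFamily G A) : f.prodS [] = 1 := rfl

@[simp]
theorem prodS_cons (f : CKFamily G A) (e : G.Edge) (μ : List G.Edge) :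
    f.prodS (e :: μ) = f.S e * f.prodS μ := List.prod_cons

theorem prodS_concat (f : CKFamily G A) (e : G.Edge) (μ : List G.Edge) :
    f.prodS (μ ++ [e]) = f.prodS μ * f.S e := by
  simp [prodS]

theorem p_mul_p_eq (f : CKFamily G A) (v w : V) :
    f.p w * f.p v = 0 ∨ f.p w * f.p v = f.p v := by
  by_cases h : w = v
  · exact .inr (h ▸ f.p_mul_self v)
  · exact .inl (f.p_orth _ _ h)

theorem p_mul_prodS_cons_eq (f : CKFamily G A) (w : V) (e : G.Edge) (μ : List G.Edge) :
    f.p w * f.prodS (e :: μ) = 0 ∨ f.p w * f.prodS (e :: μ) = f.prodS (e :: μ) := by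
  rw [prodS_cons, ← mul_assoc]
  by_cases h : e.src = w
  · subst h
    rw [p_mul_S]
    exact .inr rfl
  · rw [p_mul_S_of_ne _ h, zero_mul]
    exact .inl rfl

theorem p_mul_prodS_mul_p_eq (f : CKFamily G A) (w v : V) (μ : List G.Edge) :
    f.p w * (f.prodS μ * f.p v) = 0 ∨ f.p w * (f.prodS μ * f.p v) = f.prodS μ * f.p v := by
  rcases μ with _ | ⟨e, μ⟩
  · simpa using f.p_mul_p_eq v w
  · rw [← mul_assoc]
    rcases f.p_mul_prodS_cons_eq w e μ with h | h <;> rw [h]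
    · exact .inl (zero_mul _)
    · exact .inr rfl

/-- S_{e'}⋆ S_e is 0 or a vertex projection, and the next factor absorbs the projection or is
annihilated by it. With equal lengths the words are used up together; the value 1 comes from empty
words. -/
theorem star_prodS_mul_prodS (f : CKFamily G A) : ∀ μ ν : List G.Edge, μ.length = ν.length →
    star (f.prodS ν) * f.prodS μ = 0 ∨ star (f.prodS ν) * f.prodS μ = 1 ∨
      ∃ w, star (f.prodS ν) * f.prodS μ = f.p w
  | [], [], _ => by simp
  | e :: μ, e' :: ν, h => by
    have h1 : star (f.prodS (e' :: ν)) * f.prodS (e :: μ) =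
        star (f.prodS ν) * (star (f.S e') * f.S e * f.prodS μ) := by
      simp only [prodS_cons, star_mul, mul_assoc]
    rw [h1]
    by_cases he : e' = e
    · subst he
      rw [f.star_mul_self]
      rcases μ with _ | ⟨e'', μ⟩
      · have : ν = [] := by simpa using h.symm
        subst this
        simp
      · rcases f.p_mul_prodS_cons_eq e'.tgt e'' μ with h2 | h2
        · rw [h2, mul_zero]
          exact .inl rfl
        · rw [h2]
          exact f.star_prodS_mul_prodS _ ν (by simpa using h)
    · rw [star_S_mul_S_of_ne _ he, zero_mul, mul_zero]
      exact .inl rfl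

/-! ### Graphs all of whose vertices have exactly one neighbour -/

/-- Only one edge leaves each vertex, so the Cuntz–Krieger sum has a single term. -/
theorem S_mul_star_self (f : CKFamily G A) (huniq : ∀ v, ∃! w, G.Adj v w) (e : G.Edge) :
    f.S e * star (f.S e) = f.p e.src := by
  classical
  rw [← f.sum_edges e.src ⟨e, rfl⟩, Finset.sum_eq_single_of_mem e (by simp)]
  intro e' he' hne
  have hs : e'.src = e.src := (Finset.mem_filter.1 he').2
  exact (hne (Digraph.Edge.eq_of hs ((huniq e.src).unique (hs ▸ e'.adj) e.adj))).elim

/-- In a graph all of whose vertices have exactly one neighbour, an automorphism which moves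
vertices at most to their neighbours acts on Cuntz–Krieger families by conjugation with a unitary
which is a sum of generators. -/
theorem exists_unitary_conj_eq_permute (f : CKFamily G A)
    (hsymm : ∀ v w, G.Adj v w → G.Adj w v) (huniq : ∀ v, ∃! w, G.Adj v w) (g : G.Aut)
    (hg : ∀ v, g v = v ∨ G.Adj (g v) v) :
    ∃ x : V → A, (∀ v, x v = f.p v ∨ ∃ e, x v = f.S e) ∧
      star (∑ v, x v) * ∑ v, x v = 1 ∧ (∑ v, x v) * star (∑ v, x v) = 1 ∧
      (∀ v, (∑ v, x v) * f.p v * star (∑ v, x v) = f.p (g v)) ∧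
      ∀ e, (∑ v, x v) * f.S e * star (∑ v, x v) = f.S (g.edge e) := by
  classical
  -- `x v` is a partial isometry from p_v to p_{g v}, namely the edge from `g v` to `v` when `g`
  -- moves `v`; their sum is a unitary permuting the vertex projections as `g` does.
  let x : V → A := fun v =>
    if h : g v = v then f.p v else f.S ⟨g v, v, (hg v).resolve_left h⟩
  have hx1 : ∀ v, g v = v → x v = f.p v := fun v h => dif_pos h
  have hx2 : ∀ e : G.Edge, e.src = g e.tgt → g e.tgt ≠ e.tgt → x e.tgt = f.S e := fun e hs h =>
    (dif_neg h).trans (congrArg f.S (Digraph.Edge.eq_of hs.symm rfl))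
  have hx : ∀ v, x v = f.p v ∧ g v = v ∨ ∃ e : G.Edge, e.src = g v ∧ e.tgt = v ∧ x v = f.S e := by
    intro v
    by_cases h : g v = v
    · exact .inl ⟨hx1 v h, h⟩
    · exact .inr ⟨⟨g v, v, (hg v).resolve_left h⟩, rfl, rfl, dif_neg h⟩
  have hxx : ∀ v, star (x v) * x v = f.p v := fun v => by
    rcases hx v with ⟨h, -⟩ | ⟨e, -, rfl, h⟩ <;> rw [h]
    · rw [star_p, p_mul_self]
    · exact f.star_mul_self e
  have hxx' : ∀ v, x v * star (x v) = f.p (g v) := fun v => by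
    rcases hx v with ⟨h, h'⟩ | ⟨e, h', -, h⟩ <;> rw [h]
    · rw [star_p, p_mul_self, h']
    · rw [S_mul_star_self f huniq, h']
  have hxp : ∀ v, x v * f.p v = x v := fun v => by
    rcases hx v with ⟨h, -⟩ | ⟨e, -, rfl, h⟩ <;> rw [h]
    · rw [p_mul_self]
    · exact f.S_mul_p e
  have hpx : ∀ v, f.p (g v) * x v = x v := fun v => by
    rcases hx v with ⟨h, h'⟩ | ⟨e, h', -, h⟩ <;> rw [h]
    · rw [h', p_mul_self]
    · rw [← h', p_mul_S]
  refine ⟨x, fun v => (hx v).imp And.left fun ⟨e, _, _, h⟩ => ⟨e, h⟩, ?_⟩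
  set U := ∑ v, x v with hU
  have hUp : ∀ v, U * f.p v = x v := by
    intro v
    rw [hU, Finset.sum_mul, Finset.sum_eq_single_of_mem v (Finset.mem_univ v), hxp]
    intro w _ hw
    rw [← hxp, mul_assoc, f.p_orth _ _ hw, mul_zero]
  have hpU : ∀ v, f.p v * star U = star (x v) := fun v => by
    rw [← hUp, star_mul, star_p]
  refine ⟨?_, ?_, fun v => ?_, fun e => ?_⟩
  · rw [← f.sum_one]
    conv_lhs => rw [hU, star_sum, Finset.sum_mul]
    refine Finset.sum_congr rfl fun v _ => ?_
    rw [← hxx, Finset.mul_sum, Finset.sum_eq_single_of_mem v (Finset.mem_univ v)]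
    intro w _ hw
    rw [← hpx v, ← hpx w, star_mul, star_p, mul_assoc, ← mul_assoc (f.p (g v)),
      f.p_orth _ _ fun h => hw (g.injective h).symm, zero_mul, mul_zero]
  · rw [← f.sum_one, ← Equiv.sum_comp g.toEquiv]
    conv_lhs => rw [hU, Finset.sum_mul, ← hU]
    refine Finset.sum_congr rfl fun v _ => ?_
    rw [← hxp, mul_assoc, hpU]
    exact hxx' v
  · rw [hUp, ← hxp, mul_assoc, hpU, hxx']
  · have h1 : U * f.S e * star U = x e.src * f.S e * star (x e.tgt) := by
      rw [← hUp, ← hpU, mul_assoc U (f.p _), p_mul_S, ← mul_assoc, mul_assoc U _ (f.p _), S_mul_p]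
    rw [h1]
    have hge : G.Adj (g e.src) (g e.tgt) := g.map_rel_iff.2 e.adj
    -- By uniqueness of neighbours `g` either fixes both ends of `e` or exchanges them. If it
    -- exchanges them, with ē the reversed edge, the product is S_ē S_e S_e⋆ = S_ē.
    by_cases hs : g e.src = e.src
    · have ht : g e.tgt = e.tgt := (huniq e.src).unique (hs ▸ hge) e.adj
      rw [hx1 _ hs, hx1 _ ht, star_p, p_mul_S, S_mul_p]
      exact congrArg f.S (Digraph.Edge.eq_of hs.symm ht.symm)
    · have hs' : g e.src = e.tgt :=
        (huniq e.src).unique (hsymm _ _ ((hg e.src).resolve_left hs)) e.adj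
      have ht' : g e.tgt = e.src :=
        (huniq e.tgt).unique (hs' ▸ hge) (hsymm _ _ e.adj)
      have ht : g e.tgt ≠ e.tgt := fun h => hs (by rw [hs', ← h, ht'])
      have hge' : (g.edge e).tgt = e.src := ht'
      have h2 := hx2 (g.edge e) (congrArg g hge'.symm) (by rwa [hge'])
      rw [hge'] at h2
      rw [h2, hx2 e ht'.symm ht, mul_assoc, S_mul_star_self f huniq, ← hge', S_mul_p]

end CKFamily

namespace GraphCStar

variable {V : Type u} [Fintype V] {G : Digraph V}

theorem isHomogeneous_prodS (μ : List G.Edge) :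
    IsHomogeneous ((family G).prodS μ) μ.length := by
  induction μ with
  | nil => exact .one
  | cons e μ ih =>
    rw [CKFamily.prodS_cons, List.length_cons, Nat.cast_add, Nat.cast_one, add_comm]
    exact (isHomogeneous_S e).mul ih

variable (G) in
/-- The elements `S_μ p_v S_ν⋆`. -/
def monomials : Set (GraphCStar G) :=
  {a | ∃ μ v ν, a = (family G).prodS μ * (family G).p v * star ((family G).prodS ν)}

/-- Multiplying by S_e⋆ on the left cancels the leading letter of μ or gives 0; if μ is empty, it
lengthens ν or gives 0. -/
theorem dense_span_monomials :
    Dense (Submodule.span ℂ (monomials G) : Set (GraphCStar G)) := by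
  have hsub : ∀ a ∈ monomials G, a ∈ Submodule.span ℂ (monomials G) :=
    fun a ha => Submodule.subset_span ha
  have hp : ∀ v, ∀ a ∈ monomials G, (family G).p v * a ∈ Submodule.span ℂ (monomials G) := by
    rintro w _ ⟨μ, v, ν, rfl⟩
    rw [← mul_assoc]
    rcases (family G).p_mul_prodS_mul_p_eq w v μ with h | h <;> rw [h]
    · rw [zero_mul]
      exact Submodule.zero_mem _
    · exact hsub _ ⟨μ, v, ν, rfl⟩
  refine dense_span_of_mul_mem ?_ hp ?_ ?_
  · rw [← (family G).sum_one]
    exact Submodule.sum_mem _ fun v _ => hsub _ ⟨[], v, [], by simp⟩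
  · rintro e _ ⟨μ, v, ν, rfl⟩
    exact hsub _ ⟨e :: μ, v, ν, by simp [mul_assoc]⟩
  · rintro e _ ⟨μ, v, ν, rfl⟩
    rcases μ with _ | ⟨e', μ⟩
    · rw [CKFamily.prodS_nil, one_mul, ← mul_assoc]
      by_cases he : e.src = v
      · subst he
        refine hsub _ ⟨[], e.tgt, ν ++ [e], ?_⟩
        rw [CKFamily.star_S_mul_p, CKFamily.prodS_nil, one_mul, CKFamily.prodS_concat, star_mul,
          ← mul_assoc, CKFamily.p_mul_star_S]
      · rw [CKFamily.star_S_mul_p_of_ne _ he, zero_mul]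
        exact Submodule.zero_mem _
    · rw [CKFamily.prodS_cons, ← mul_assoc, ← mul_assoc, ← mul_assoc]
      by_cases he : e = e'
      · subst he
        rw [CKFamily.star_mul_self, mul_assoc, mul_assoc, ← mul_assoc ((family G).prodS μ)]
        exact hp _ _ ⟨μ, v, ν, rfl⟩
      · rw [CKFamily.star_S_mul_S_of_ne _ he]
        simp

/-! ### KMS states and their values at the vertices -/

/-- At nonzero inverse temperature KMS states are determined by their values at the vertices. -/
theorem _root_.IsKMSState.ext_of_apply_p {β : ℝ} (hβ : β ≠ 0) {τ τ' : GraphCStar G →L[ℂ] ℂ}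
    (hτ : IsKMSState (dynamics G) β τ) (hτ' : IsKMSState (dynamics G) β τ')
    (h : ∀ v, τ ((family G).p v) = τ' ((family G).p v)) : τ = τ' := by
  refine ContinuousLinearMap.ext_on dense_span_monomials ?_
  rintro _ ⟨μ, v, ν, rfl⟩
  by_cases hlen : μ.length = ν.length
  · rw [mul_assoc, hτ.apply_homogeneous_mul (isHomogeneous_prodS μ),
      hτ'.apply_homogeneous_mul (isHomogeneous_prodS μ), mul_assoc]
    congr 1
    rcases (family G).star_prodS_mul_prodS μ ν hlen with h1 | h1 | ⟨w, h1⟩ <;> rw [h1]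
    · simp
    · rw [mul_one, h]
    · rcases (family G).p_mul_p_eq w v with h2 | h2 <;> rw [h2]
      · simp
      · exact h w
  · have hhom := ((isHomogeneous_prodS (G := G) μ).mul (isHomogeneous_p v)).mul
      (isHomogeneous_prodS ν).star
    have key : ∀ σ : GraphCStar G →L[ℂ] ℂ, IsKMSState (dynamics G) β σ →
        σ ((family G).prodS μ * (family G).p v * star ((family G).prodS ν)) = 0 := by
      intro σ hσ
      -- With b = 1 an element of degree d satisfies σ(a) = exp(-dβ) σ(a). Since d and β are
      -- nonzero, σ(a) = 0.
      have h1 := hσ.apply_homogeneous_mul hhom 1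
      rw [mul_one, one_mul] at h1
      by_contra h0
      have h2 := mul_right_cancel₀ h0 ((one_mul _).trans h1)
      have h3 : Real.exp (-(((μ.length + 0 + -ν.length : ℤ) : ℝ) * β)) = 1 := by
        exact_mod_cast h2.symm
      rw [Real.exp_eq_one_iff, neg_eq_zero, mul_eq_zero, or_iff_left hβ] at h3
      norm_cast at h3
      omega
    rw [key τ hτ, key τ' hτ']

theorem _root_.IsKMSState.apply_p_re_nonneg {β : ℝ} {τ : GraphCStar G →L[ℂ] ℂ}
    (hτ : IsKMSState (dynamics G) β τ) (v : V) :
    0 ≤ (τ ((family G).p v)).re ∧ τ ((family G).p v) = ((τ ((family G).p v)).re : ℂ) := by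
  have h := hτ.1.1 ((family G).p v)
  rw [CKFamily.star_p, CKFamily.p_mul_self] at h
  exact ⟨(Complex.nonneg_iff.1 h).1, Complex.ext rfl (Complex.nonneg_iff.1 h).2.symm⟩

/-- The values of a KMS state at the vertices form an eigenvector of the vertex matrix. -/
theorem _root_.IsKMSState.isEigenvector {lam : ℝ} (hlam : 0 < lam)
    (hG : ∀ v, ∃ e : G.Edge, e.src = v) {τ : GraphCStar G →L[ℂ] ℂ}
    (hτ : IsKMSState (dynamics G) (Real.log lam) τ) :
    G.IsEigenvector lam fun v => (τ ((family G).p v)).re := by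
  classical
  intro v
  have hexp : Complex.exp (Real.log lam) = lam := by
    rw [← Complex.ofReal_exp, Real.exp_log hlam]
  -- The KMS condition for S_e, which has degree one; summation over the edges leaving `v` uses that
  -- `v` is not a sink.
  have h1 : ∀ e : G.Edge, τ ((family G).S e * star ((family G).S e)) =
      (lam : ℂ)⁻¹ * τ ((family G).p e.tgt) := by
    intro e
    rw [hτ.apply_homogeneous_mul (isHomogeneous_S e), CKFamily.star_mul_self, Int.cast_one,
      one_mul, Complex.exp_neg, hexp]
  have h2 : τ ((family G).p v) =
      (lam : ℂ)⁻¹ * ∑ w, if G.Adj v w then τ ((family G).p w) else 0 := by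
    rw [← sum_edge_eq v fun w => τ ((family G).p w), ← (family G).sum_edges v (hG v), map_sum,
      Finset.mul_sum]
    exact Finset.sum_congr rfl fun e _ => h1 e
  have hlam0 : (lam : ℂ) ≠ 0 := by exact_mod_cast hlam.ne'
  rw [eq_inv_mul_iff_mul_eq₀ hlam0] at h2
  have h3 := congrArg Complex.re h2
  rw [Complex.re_ofReal_mul, Complex.re_sum] at h3
  rw [h3]
  exact Finset.sum_congr rfl fun w _ => by split_ifs <;> simp

/-! ### The action of automorphisms on KMS states -/

theorem autAction_p (g : G.Aut) (v : V) :
    autAction g ((family G).p v) = (family G).p (g v) := lift_p _ v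

theorem autAction_S (g : G.Aut) (e : G.Edge) :
    autAction g ((family G).S e) = (family G).S (g.edge e) := lift_S _ e

theorem dynamics_autAction (g : G.Aut) (t : ℝ) (a : GraphCStar G) :
    dynamics G t (autAction g a) = autAction g (dynamics G t a) := by
  have : (dynamics G t).comp (autAction g) = (autAction g).comp (dynamics G t) := by
    refine hom_ext (fun v => ?_) fun e => ?_
    · simp [autAction_p, dynamics_p]
    · simp [autAction_S, dynamics_S]
  exact congrArg (fun f => f a) this

/-- `autAction` as a continuous linear map. -/
noncomputable def autActionL (g : G.Aut) : GraphCStar G →L[ℂ] GraphCStar G :=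
  ⟨(autAction g).toAlgHom.toLinearMap, continuous_liftFun _⟩

theorem autActionL_apply (g : G.Aut) (a : GraphCStar G) : autActionL g a = autAction g a := rfl

/-- The action commutes with the dynamics, so it carries entire orbits to entire orbits. -/
theorem _root_.IsKMSState.comp_autAction {β : ℝ} {τ : GraphCStar G →L[ℂ] ℂ}
    (hτ : IsKMSState (dynamics G) β τ) (g : G.Aut) :
    IsKMSState (dynamics G) β (τ.comp (autActionL g)) := by
  have horb : ∀ {a : GraphCStar G} {F : ℂ → GraphCStar G}, IsEntireOrbit (dynamics G) a F →
      IsEntireOrbit (dynamics G) (autAction g a) fun z => autAction g (F z) :=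
    fun hF => ⟨(autActionL g).differentiable.comp hF.1, fun t => by
      simp only [hF.2, dynamics_autAction]⟩
  refine ⟨⟨fun a => ?_, ?_⟩, fun a b F H hF hH => ?_⟩
  · rw [ContinuousLinearMap.comp_apply, autActionL_apply, map_mul, map_star]
    exact hτ.1.1 _
  · rw [ContinuousLinearMap.comp_apply, autActionL_apply, map_one]
    exact hτ.1.2
  · simp only [ContinuousLinearMap.comp_apply, autActionL_apply, map_mul]
    exact hτ.2 _ _ _ _ (horb hF) (horb hH)

/-- In a graph all of whose vertices have exactly one neighbour, automorphisms which move vertices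
at most to their neighbours fix traces. -/
theorem _root_.IsKMSState.apply_autAction_of_existsUnique {τ : GraphCStar G →L[ℂ] ℂ}
    (hτ : IsKMSState (dynamics G) 0 τ) (hsymm : ∀ v w, G.Adj v w → G.Adj w v)
    (huniq : ∀ v, ∃! w, G.Adj v w) (g : G.Aut) (hg : ∀ v, g v = v ∨ G.Adj (g v) v)
    (a : GraphCStar G) : τ (autAction g a) = τ a := by
  obtain ⟨x, hx, hUU, hUU', hp, hS⟩ :=
    (family G).exists_unitary_conj_eq_permute hsymm huniq g hg
  let U : unitary (GraphCStar G) := ⟨∑ v, x v, Unitary.mem_iff.2 ⟨hUU, hUU'⟩⟩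
  have hconj : autAction g =
      (Unitary.conjStarAlgAut ℂ (GraphCStar G) U : GraphCStar G →⋆ₐ[ℂ] GraphCStar G) :=
    hom_ext (fun v => (autAction_p g v).trans (hp v).symm)
      (fun e => (autAction_S g e).trans (hS e).symm)
  -- At β = 0 the KMS factor is 1, so τ commutes with generators and thus with the unitary, which is
  -- a sum of them.
  have hcomm : ∀ b, τ ((∑ v, x v) * b) = τ (b * ∑ v, x v) := by
    intro b
    rw [Finset.sum_mul, Finset.mul_sum, map_sum, map_sum]
    refine Finset.sum_congr rfl fun v _ => ?_
    rcases hx v with h | ⟨e, h⟩ <;> rw [h]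
    · simpa using hτ.apply_homogeneous_mul (isHomogeneous_p v) b
    · simpa using hτ.apply_homogeneous_mul (isHomogeneous_S e) b
  rw [hconj]
  change τ ((∑ v, x v) * a * star (∑ v, x v)) = τ a
  rw [mul_assoc, hcomm, mul_assoc, hUU, mul_one]

end GraphCStar

/-! ### Disjoint unions of connected graphs -/

namespace UndirectedGraph

variable {V : Type u} {W : Type v} {Γ : UndirectedGraph V} {Λ : UndirectedGraph W}

/-- The graphs with one vertex and no loop are isomorphic. -/
theorem nonempty_iso_of_not_adj (h₁ : Γ.Connected) (h₂ : Λ.Connected)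
    (hΓ : ∀ v w, ¬ Γ.Adj v w) (hΛ : ∀ v w, ¬ Λ.Adj v w) : Nonempty (Γ.Iso Λ) := by
  obtain ⟨v₀⟩ := h₁.1
  obtain ⟨w₀⟩ := h₂.1
  have hv : ∀ v, v = v₀ := fun v => by
    rcases (h₁.2 v₀ v).cases_tail with h | ⟨u, -, h⟩
    exacts [h, (hΓ _ _ h).elim]
  have hw : ∀ w, w = w₀ := fun w => by
    rcases (h₂.2 w₀ w).cases_tail with h | ⟨u, -, h⟩
    exacts [h, (hΛ _ _ h).elim]
  exact ⟨⟨⟨fun _ => w₀, fun _ => v₀, fun v => (hv v).symm, fun w => (hw w).symm⟩,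
    fun {a b} => iff_of_false (hΛ _ _) (hΓ _ _)⟩⟩

/-- At a vertex without neighbours the equation would read 0 = λ x_v. This guarantees that there are
no sinks. -/
theorem exists_adj_of_pos_eigenvector [Fintype V] {lam : ℝ} (hlam : 0 < lam) {x : V → ℝ}
    (hx : ∀ v, 0 < x v) (he : Γ.directed.IsEigenvector lam x) (v : V) : ∃ w, Γ.Adj v w := by
  by_contra! h
  exact (mul_pos hlam (hx v)).ne ((Finset.sum_eq_zero fun w _ => if_neg (h w)).symm.trans (he v))

theorem exists_edge_disjUnion (hΓ : ∀ v, ∃ w, Γ.Adj v w) (hΛ : ∀ v, ∃ w, Λ.Adj v w)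
    (v : V ⊕ W) : ∃ e : (Γ.disjUnion Λ).directed.Edge, e.src = v := by
  rcases v with v | v
  · obtain ⟨w, h⟩ := hΓ v
    exact ⟨⟨Sum.inl v, Sum.inl w, Sum.LiftRel.inl h⟩, rfl⟩
  · obtain ⟨w, h⟩ := hΛ v
    exact ⟨⟨Sum.inr v, Sum.inr w, Sum.LiftRel.inr h⟩, rfl⟩

theorem existsUnique_adj_disjUnion (hΓ : ∀ v, ∃! w, Γ.Adj v w) (hΛ : ∀ v, ∃! w, Λ.Adj v w)
    (v : V ⊕ W) : ∃! w, (Γ.disjUnion Λ).directed.Adj v w := by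
  rcases v with v | v
  · obtain ⟨w, h, hw⟩ := hΓ v
    refine ⟨Sum.inl w, Sum.LiftRel.inl h, ?_⟩
    rintro _ (⟨hadj⟩ | _)
    exact congrArg Sum.inl (hw _ hadj)
  · obtain ⟨w, h, hw⟩ := hΛ v
    refine ⟨Sum.inr w, Sum.LiftRel.inr h, ?_⟩
    rintro _ (_ | ⟨hadj⟩)
    exact congrArg Sum.inr (hw _ hadj)

/-- A connected graph all of whose vertices have exactly one neighbour is complete. -/
theorem eq_or_adj_of_existsUnique (h : Γ.Connected) (huniq : ∀ v, ∃! w, Γ.Adj v w) (v w : V) :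
    w = v ∨ Γ.Adj w v := by
  induction h.2 v w with
  | refl => exact .inl rfl
  | @tail b c _ hbc ih =>
    -- A path alternates between `v` and its only neighbour.
    rcases ih with rfl | hb
    · exact .inr (Γ.symm _ _ hbc)
    · exact .inl ((huniq b).unique hbc hb)

/-- The union of two connected graphs with the same spectral radius has infinitely many KMS
states at the critical inverse temperature. -/
theorem infinite_isKMSState [Fintype V] [Fintype W] {lam : ℝ} (hlam : 0 < lam)
    {x : V → ℝ} (hx : ∀ v, 0 < x v) (hx1 : ∑ v, x v = 1) (hxe : Γ.directed.IsEigenvector lam x)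
    {y : W → ℝ} (hy : ∀ v, 0 < y v) (hy1 : ∑ v, y v = 1) (hye : Λ.directed.IsEigenvector lam y) :
    {τ : GraphCStar (Γ.disjUnion Λ).directed →L[ℂ] ℂ |
      IsKMSState (GraphCStar.dynamics (Γ.disjUnion Λ).directed) (Real.log lam) τ}.Infinite := by
  have hex : ∀ s : Set.Icc (0 : ℝ) 1, ∃ τ : GraphCStar (Γ.disjUnion Λ).directed →L[ℂ] ℂ,
      IsKMSState (GraphCStar.dynamics (Γ.disjUnion Λ).directed) (Real.log lam) τ ∧
        ∀ v, τ ((GraphCStar.family _).p v) =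
          (Sum.elim (fun v => s.1 * x v) (fun w => (1 - s.1) * y w) v : ℝ) := by
    intro s
    refine GraphCStar.exists_isKMSState hlam (exists_edge_disjUnion
      (exists_adj_of_pos_eigenvector hlam hx hxe) (exists_adj_of_pos_eigenvector hlam hy hye))
      ?_ ?_ ?_
    · rintro (v | w)
      · exact mul_nonneg s.2.1 (hx v).le
      · exact mul_nonneg (sub_nonneg.2 s.2.2) (hy w).le
    · simp [← Finset.mul_sum, hx1, hy1]
    · exact isEigenvector_disjUnion.2 ⟨hxe.const_mul s.1, hye.const_mul (1 - s.1)⟩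
  choose τ hτ hτp using hex
  have := (Set.Icc_infinite (zero_lt_one (α := ℝ))).to_subtype
  refine Set.infinite_of_injective_forall_mem (f := τ) (fun s t hst => ?_) hτ
  obtain ⟨v⟩ : Nonempty V := by
    by_contra h
    rw [not_nonempty_iff] at h
    simp at hx1
  have h1 := hτp s (Sum.inl v)
  rw [hst, hτp t (Sum.inl v), Complex.ofReal_inj] at h1
  -- The value s x_v at one vertex recovers s because x_v > 0.
  exact Subtype.ext (mul_right_cancel₀ (hx v).ne' h1.symm)

/-- KMS states of the union of two non-isomorphic connected graphs at the critical inverse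
temperature are invariant under automorphisms. -/
theorem isKMSState_apply_autAction [Fintype V] [Fintype W] (h₁ : Γ.Connected) (h₂ : Λ.Connected)
    (hiso : IsEmpty (Γ.Iso Λ)) {lam : ℝ} (hlam : 0 < lam)
    {x : V → ℝ} (hx : ∀ v, 0 < x v) (hxe : Γ.directed.IsEigenvector lam x)
    {y : W → ℝ} (hy : ∀ v, 0 < y v) (hye : Λ.directed.IsEigenvector lam y)
    {τ : GraphCStar (Γ.disjUnion Λ).directed →L[ℂ] ℂ}
    (hτ : IsKMSState (GraphCStar.dynamics (Γ.disjUnion Λ).directed) (Real.log lam) τ)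
    (g : (Γ.disjUnion Λ).directed.Aut) (a : GraphCStar (Γ.disjUnion Λ).directed) :
    τ (GraphCStar.autAction g a) = τ a := by
  obtain ⟨k, rfl⟩ := exists_autSum h₁ h₂ hiso g
  -- For λ = 1 vertex values do not determine the state, and invariance comes from unitary
  -- conjugation instead.
  rcases eq_or_ne lam 1 with rfl | hlam1
  · rw [Real.log_one] at hτ
    have hu₁ := existsUnique_adj_of_eigenvalue_one h₁ hx hxe
    have hu₂ := existsUnique_adj_of_eigenvalue_one h₂ hy hye
    refine hτ.apply_autAction_of_existsUnique (Γ.disjUnion Λ).symm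
      (existsUnique_adj_disjUnion hu₁ hu₂) _ ?_ a
    rintro (v | w)
    · exact (eq_or_adj_of_existsUnique h₁ hu₁ v (k.1 v)).imp (congrArg Sum.inl) Sum.LiftRel.inl
    · exact (eq_or_adj_of_existsUnique h₂ hu₂ w (k.2 w)).imp (congrArg Sum.inr) Sum.LiftRel.inr
  · have hG := exists_edge_disjUnion (exists_adj_of_pos_eigenvector hlam hx hxe)
      (exists_adj_of_pos_eigenvector hlam hy hye)
    have he := isEigenvector_disjUnion.1 (hτ.isEigenvector hlam hG)
    -- The translated state is again KMS, and its vertex values agree with those of `τ` by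
    -- invariance of eigenvectors on each part.
    have heq : τ.comp (GraphCStar.autActionL (autSum k)) = τ := by
      refine (hτ.comp_autAction _).ext_of_apply_p
        (Real.log_ne_zero_of_pos_of_ne_one hlam hlam1) hτ fun v => ?_
      rw [ContinuousLinearMap.comp_apply, GraphCStar.autActionL_apply, GraphCStar.autAction_p,
        (hτ.apply_p_re_nonneg _).2, (hτ.apply_p_re_nonneg v).2]
      congr 1
      rcases v with v | w
      · exact eigenvector_aut h₁ (fun v => (hτ.apply_p_re_nonneg _).1) he.1 k.1 v
      · exact eigenvector_aut h₂ (fun v => (hτ.apply_p_re_nonneg _).1) he.2 k.2 w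
    exact congrArg (fun f => f a) heq

end UndirectedGraph

/-! ### The proposition. -/

theorem mainTheorem4 {V₁ : Type u} {V₂ : Type v} [Fintype V₁] [DecidableEq V₁] [Fintype V₂]
    [DecidableEq V₂] (Γ₁ : UndirectedGraph V₁) (Γ₂ : UndirectedGraph V₂)
    (hconn₁ : Γ₁.Connected) (hconn₂ : Γ₂.Connected) (hiso : IsEmpty (Γ₁.Iso Γ₂)) (lam : ℝ≥0)
    (hlam₁ : spectralRadius ℂ Γ₁.directed.vertexMatrix = lam)
    (hlam₂ : spectralRadius ℂ Γ₂.directed.vertexMatrix = lam) :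
    spectralRadius ℂ (Γ₁.disjUnion Γ₂).directed.vertexMatrix = lam ∧
    {τ : GraphCStar (Γ₁.disjUnion Γ₂).directed →L[ℂ] ℂ |
      IsKMSState (GraphCStar.dynamics (Γ₁.disjUnion Γ₂).directed) (Real.log lam) τ}.Infinite ∧
    (∀ τ : GraphCStar (Γ₁.disjUnion Γ₂).directed →L[ℂ] ℂ,
      IsKMSState (GraphCStar.dynamics (Γ₁.disjUnion Γ₂).directed) (Real.log lam) τ →
      ∀ (g : (Γ₁.disjUnion Γ₂).directed.Aut) (a : GraphCStar (Γ₁.disjUnion Γ₂).directed),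
        τ (GraphCStar.autAction g a) = τ a) ∧
    ∃ Φ : Γ₁.directed.Aut × Γ₂.directed.Aut ≃* (Γ₁.disjUnion Γ₂).directed.Aut,
      ∀ g₁ g₂, (∀ v, Φ (g₁, g₂) (Sum.inl v) = Sum.inl (g₁ v)) ∧
        ∀ w, Φ (g₁, g₂) (Sum.inr w) = Sum.inr (g₂ w) := by
  -- Spectral radius zero would make both graphs edgeless, hence single points and isomorphic.
  -- Positivity is needed to write λ = exp(`log lam`).
  have hlam : 0 < (lam : ℝ) := by
    rw [NNReal.coe_pos, pos_iff_ne_zero]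
    rintro rfl
    obtain ⟨f⟩ := UndirectedGraph.nonempty_iso_of_not_adj hconn₁ hconn₂
      (UndirectedGraph.not_adj_of_spectralRadius_eq_zero hlam₁)
      (UndirectedGraph.not_adj_of_spectralRadius_eq_zero hlam₂)
    exact hiso.false f
  obtain ⟨x, hx, hx1, hxe⟩ := UndirectedGraph.exists_pos_eigenvector hconn₁ hlam₁
  obtain ⟨y, hy, hy1, hye⟩ := UndirectedGraph.exists_pos_eigenvector hconn₂ hlam₂
  obtain ⟨Φ, hΦ⟩ := UndirectedGraph.exists_autSum_mulEquiv hconn₁ hconn₂ hiso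
  refine ⟨?_, UndirectedGraph.infinite_isKMSState hlam hx hx1 hxe hy hy1 hye,
    fun τ hτ => UndirectedGraph.isKMSState_apply_autAction hconn₁ hconn₂ hiso hlam hx hxe hy hye hτ,
    Φ, fun g₁ g₂ => ⟨fun v => ?_, fun w => ?_⟩⟩
  · rw [UndirectedGraph.spectralRadius_disjUnion, hlam₁, hlam₂, sup_idem]
  · rw [hΦ]
    rfl
  · rw [hΦ]
    rfl
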